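/- Let $V$ be a real vector space of dimension $6$, and let $(\Lambda^6V)^{1/2}$ be a square root of the line $\Lambda^6V$, i.e. a real line with an isomorphism $(\Lambda^6V)^{1/2}\otimes(\Lambda^6V)^{1/2}\cong\Lambda^6V$. The space $V\oplus V^*$, with the natural inner product $(v+\xi,v+\xi)=-\xi(v)$, acts on $\Lambda^*V^*\otimes(\Lambda^6V)^{1/2}$ by $(v+\xi)\cdot\varphi=\iota(v)\varphi+\xi\wedge\varphi$; this makes $S=\Lambda^{ev}V^*\otimes(\Lambda^6V)^{1/2}$ a $32$-dimensional real spin representation of $\mathrm{Spin}(V\oplus V^*)\cong \mathrm{Spin}(6,6)$. Write $\sigma:\mathfrak{so}(V\oplus V^*)\to\mathrm{End}\,S$ for the corresponding representation of Lie algebras, and $$\langle\varphi,\psi\rangle=\sum_m(-1)^m\varphi_{2m}\wedge\psi_{6-2m}\in\Lambda^6V^*\otimes\Lambda^6V=\mathbf{R}$$ for the invariant bilinear form on $S$. The moment map $\mu:S\to\mathfrak{so}(V\oplus V^*)$ is defined by $\mathrm{tr}(\mu(\rho)a)=\tfrac12\langle\sigma(a)\rho,\rho\rangle$ for all $a\in\mathfrak{so}(V\oplus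 V^*)$, where $\mathrm{tr}$ is the trace on $V\oplus V^*$, and $q(\rho)=\mathrm{tr}\,\mu(\rho)^2$. Extend the action and the form complex-(bi)linearly to $S\otimes\mathbf{C}$. A spinor $\varphi\in S\otimes\mathbf{C}$ is called pure if its annihilator $E_\varphi=\{w\in(V\oplus V^*)\otimes\mathbf{C}: w\cdot\varphi=0\}$ has complex dimension $6=\dim V$. Proposition. Let $\rho\in S$ be a real spinor with $q(\rho)<0$. Then there is a pure spinor $\varphi\in S\otimes\mathbf{C}$ such that $\rho$ is the real part of $\varphi$ and $\langle\varphi,\bar\varphi\rangle\neq0$. -/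

import Mathlib

open scoped TensorProduct

noncomputable section

namespace SpinSix

section Clifford

variable (V : Type*) [AddCommGroup V] [Module ℝ V]

/-- The space `V ⊕ V*`; an element `v + ξ` is written as the pair `(ξ, v)`. -/
def Doubled : Type _ := Module.Dual ℝ V × V

instance : AddCommGroup (Doubled V) := inferInstanceAs (AddCommGroup (Module.Dual ℝ V × V))

instance : Module ℝ (Doubled V) := inferInstanceAs (Module ℝ (Module.Dual ℝ V × V))

instance [FiniteDimensional ℝ V] : FiniteDimensional ℝ (Doubled V) :=
  inferInstanceAs (FiniteDimensional ℝ (Module.Dual ℝ V × V))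

/-- The inclusion of `V` in `V ⊕ V*`. -/
def vec : V →ₗ[ℝ] Doubled V := LinearMap.inr ℝ (Module.Dual ℝ V) V

/-- The inclusion of `V*` in `V ⊕ V*`. -/
def covec : Module.Dual ℝ V →ₗ[ℝ] Doubled V := LinearMap.inl ℝ (Module.Dual ℝ V) V

/-- The symmetric bilinear form `(v + ξ, w + η) ↦ ξ(w) + η(v)` on `V ⊕ V*`. -/
def pairing : LinearMap.BilinForm ℝ (Doubled V) := LinearMap.dualProd ℝ V

variable {V} in
theorem pairing_apply (u w : Doubled V) : pairing V u w = w.1 u.2 + u.1 w.2 := rfl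

variable {V} in
@[simp] theorem pairing_vec (v : V) (w : Doubled V) : pairing V (vec V v) w = w.1 v := by
  change w.1 v + (0 : Module.Dual ℝ V) w.2 = _
  simp

variable {V} in
@[simp] theorem pairing_covec (ξ : Module.Dual ℝ V) (w : Doubled V) :
    pairing V (covec V ξ) w = ξ w.2 := by
  change w.1 0 + ξ w.2 = _
  simp

variable {V} in
theorem covec_add_vec (w : Doubled V) : covec V w.1 + vec V w.2 = w :=
  Prod.ext (add_zero w.1) (zero_add w.2)

variable {V} in
theorem pairing_comm (u w : Doubled V) : pairing V u w = pairing V w u := by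
  rw [pairing_apply, pairing_apply, add_comm]

/-- The exterior algebra `Λ*V*`. -/
abbrev Forms : Type _ := ExteriorAlgebra ℝ (Module.Dual ℝ V)

/-- The action of `V ⊕ V*` on `Λ*V*`, `(v + ξ) · φ = ι(v) φ + ξ ∧ φ`. -/
def clifford : Doubled V →ₗ[ℝ] Module.End ℝ (Forms V) :=
  LinearMap.coprod (R := ℝ) (M := Module.Dual ℝ V) (M₂ := V)
    ((LinearMap.mul ℝ (Forms V)) ∘ₗ ExteriorAlgebra.ι ℝ)
    ((CliffordAlgebra.contractLeft (Q := (0 : QuadraticForm ℝ (Module.Dual ℝ V)))) ∘ₗ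
      Module.Dual.eval ℝ V)

theorem clifford_apply (w : Doubled V) (φ : Forms V) :
    clifford V w φ = ExteriorAlgebra.ι ℝ w.1 * φ +
      CliffordAlgebra.contractLeft (Q := (0 : QuadraticForm ℝ (Module.Dual ℝ V)))
        (Module.Dual.eval ℝ V w.2) φ := rfl

/-- The Clifford relation: `(v + ξ)² = ξ(v)`. -/
theorem clifford_sq (w : Doubled V) :
    clifford V w * clifford V w = w.1 w.2 • (1 : Module.End ℝ (Forms V)) := by
  refine LinearMap.ext fun φ => ?_
  have h := CliffordAlgebra.contractLeft_ι_mul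
    (Q := (0 : QuadraticForm ℝ (Module.Dual ℝ V))) (Module.Dual.eval ℝ V w.2) w.1 φ
  have h2 := CliffordAlgebra.contractLeft_contractLeft
    (Q := (0 : QuadraticForm ℝ (Module.Dual ℝ V))) (d := Module.Dual.eval ℝ V w.2) φ
  have h3 : ExteriorAlgebra.ι ℝ w.1 * (ExteriorAlgebra.ι ℝ w.1 * φ) = 0 := by
    rw [← mul_assoc, ExteriorAlgebra.ι_sq_zero, zero_mul]
  simp only [Module.End.mul_apply, clifford_apply, map_add, h2, h3,
    LinearMap.smul_apply, Module.End.one_apply]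
  erw [h]
  simp [ExteriorAlgebra.ι]

variable {V}

theorem clifford_anticomm (u w : Doubled V) :
    clifford V u * clifford V w + clifford V w * clifford V u =
      pairing V u w • (1 : Module.End ℝ (Forms V)) := by
  have h := clifford_sq V (u + w)
  have hu := clifford_sq V u
  have hw := clifford_sq V w
  have e : (u + w).1 (u + w).2 = u.1 u.2 + w.1 w.2 + pairing V u w := by
    rw [pairing_apply]
    change (u.1 + w.1) (u.2 + w.2) = _
    simp only [map_add, LinearMap.add_apply]
    ring
  rw [e, map_add, add_mul, mul_add, mul_add, hu, hw, add_smul, add_smul] at h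
  refine add_left_cancel (a := u.1 u.2 • 1 + w.1 w.2 • 1) (Eq.trans ?_ h)
  abel

variable (V)

/-- The Lie algebra `𝔰𝔬(V ⊕ V*)` (as a vector space): the endomorphisms that are skew for the
natural inner product `(v + ξ, w + η) ↦ ξ(w) + η(v)`. -/
def so : Submodule ℝ (Module.End ℝ (Doubled V)) where
  carrier := {a | ∀ u w, pairing V (a u) w = -pairing V u (a w)}
  add_mem' {a b} ha hb u w := by
    rw [LinearMap.add_apply, LinearMap.add_apply, map_add, map_add, LinearMap.add_apply, ha, hb,
      neg_add]
  zero_mem' u w := by simp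
  smul_mem' c a ha u w := by
    rw [LinearMap.smul_apply, LinearMap.smul_apply, map_smul, map_smul, LinearMap.smul_apply, ha,
      smul_neg]

variable {V}

theorem mem_so_iff (a : Module.End ℝ (Doubled V)) :
    a ∈ so V ↔ ∀ u w, pairing V (a u) w = -pairing V u (a w) :=
  Iff.rfl

theorem eq_zero_of_pairing (u : Doubled V) (h : ∀ w, pairing V w u = 0) : u = 0 := by
  have h1 : u.1 = 0 := LinearMap.ext fun v => by simpa [pairing_comm u] using h (vec V v)
  have h2 : u.2 = 0 := (Module.forall_dual_apply_eq_zero_iff ℝ u.2).1 fun ξ => by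
    simpa using h (covec V ξ)
  exact Prod.ext h1 h2

/-- The element `x ↦ (w, x) u - (u, x) w` of `𝔰𝔬(V ⊕ V*)`. -/
def wedge (u w : Doubled V) : so V :=
  ⟨(pairing V w).smulRight u - (pairing V u).smulRight w, by
    rw [mem_so_iff]
    intro x y
    simp only [LinearMap.sub_apply, LinearMap.smulRight_apply, map_sub, map_smul,
      LinearMap.smul_apply, smul_eq_mul, pairing_comm x]
    ring⟩

end Clifford

section Finite

variable (V : Type*) [AddCommGroup V] [Module ℝ V]

/-- The inner product `tr(XY)` on `𝔰𝔬(V ⊕ V*)`. -/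
def traceForm : LinearMap.BilinForm ℝ (so V) :=
  ((LinearMap.mul ℝ (Module.End ℝ (Doubled V))).compr₂
    (LinearMap.trace ℝ (Doubled V))).domRestrict₁₂ (so V) (so V)

theorem traceForm_apply (a b : so V) :
    traceForm V a b = LinearMap.trace ℝ (Doubled V) (a.1 * b.1) := rfl

variable [FiniteDimensional ℝ V]

theorem traceForm_nondegenerate : (traceForm V).Nondegenerate := by
  have hsymm : (traceForm V).IsSymm :=
    ⟨fun a b => by simp only [traceForm_apply]; exact LinearMap.trace_mul_comm ℝ _ _⟩
  refine (LinearMap.IsRefl.nondegenerate_iff_separatingLeft (B := traceForm V)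
    (fun x y h => (hsymm.eq y x).trans h)).2 ?_
  intro a ha
  refine Subtype.ext (LinearMap.ext fun u => eq_zero_of_pairing _ fun w => ?_)
  have h := ha (wedge u w)
  have hmul : a.1 * (wedge u w).1 =
      (pairing V w).smulRight (a.1 u) -
        (pairing V u).smulRight (a.1 w) := by
    refine LinearMap.ext fun x => ?_
    simp [wedge]
  rw [traceForm_apply, hmul, map_sub, LinearMap.trace_smulRight, LinearMap.trace_smulRight] at h
  have hs := (mem_so_iff a.1).1 a.2 u w
  have hc := pairing_comm (a.1 u) w
  linarith

/-- The infinitesimal spin representation `𝔰𝔬(V ⊕ V*) → End Λ*V*`: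
`a ↦ ½ ∑ᵢ (a eᵢ)·(eⁱ)· + (a eⁱ)·(eᵢ)·`, where `eᵢ` is a basis of `V` and `eⁱ` the dual basis of `V*`.
It does not depend on the basis; `spinRep_commutator` is its characteristic property. -/
def spinRep : so V →ₗ[ℝ] Module.End ℝ (Forms V) :=
  ((1 / 2 : ℝ) • ∑ i : Fin (Module.finrank ℝ V),
    ((LinearMap.mulRight ℝ (clifford V (covec V ((Module.finBasis ℝ V).coord i)))) ∘ₗ clifford V ∘ₗ
        LinearMap.applyₗ (R := ℝ) (vec V (Module.finBasis ℝ V i)) +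
      (LinearMap.mulRight ℝ (clifford V (vec V (Module.finBasis ℝ V i)))) ∘ₗ clifford V ∘ₗ
        LinearMap.applyₗ (R := ℝ) (covec V ((Module.finBasis ℝ V).coord i)))) ∘ₗ (so V).subtype

theorem spinRep_apply (a : so V) :
    spinRep V a = (1 / 2 : ℝ) • ∑ i : Fin (Module.finrank ℝ V),
      (clifford V (a.1 (vec V (Module.finBasis ℝ V i))) *
          clifford V (covec V ((Module.finBasis ℝ V).coord i)) +
        clifford V (a.1 (covec V ((Module.finBasis ℝ V).coord i))) *
          clifford V (vec V (Module.finBasis ℝ V i))) := by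
  simp [spinRep]

theorem sum_pairing (w : Doubled V) :
    ∑ i, (pairing V (covec V ((Module.finBasis ℝ V).coord i)) w •
        vec V (Module.finBasis ℝ V i) +
      pairing V (vec V (Module.finBasis ℝ V i)) w •
        covec V ((Module.finBasis ℝ V).coord i)) = w := by
  simp only [pairing_covec, pairing_vec, Finset.sum_add_distrib, ← map_smul, ← map_sum]
  rw [Module.Basis.sum_dual_apply_smul_coord]
  simp only [Module.Basis.coord_apply, Module.Basis.sum_repr]
  rw [add_comm, covec_add_vec]

/-- `[σ(a), w·] = (a w)·` for `a ∈ 𝔰𝔬(V ⊕ V*)` and `w ∈ V ⊕ V*`. -/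
theorem spinRep_commutator (a : so V) (w : Doubled V) :
    spinRep V a * clifford V w - clifford V w * spinRep V a = clifford V (a.1 w) := by
  have key : ∀ e e' : Doubled V,
      clifford V (a.1 e) * clifford V e' * clifford V w -
        clifford V w * (clifford V (a.1 e) * clifford V e') =
      clifford V (a.1 (pairing V e' w • e)) +
        clifford V (pairing V e (a.1 w) • e') := by
    intro e e'
    have h1 := clifford_anticomm e' w
    have h2 := clifford_anticomm (a.1 e) w
    rw [(mem_so_iff a.1).1 a.2 e w] at h2
    have h1' := congrArg (fun t => clifford V (a.1 e) * t) h1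
    have h2' := congrArg (fun t => t * clifford V e') h2
    simp only [mul_add, add_mul, mul_smul_comm, smul_mul_assoc, mul_one, one_mul]
      at h1' h2'
    have e1 : clifford V (a.1 (pairing V e' w • e)) =
        pairing V e' w • clifford V (a.1 e) := by simp only [map_smul]
    have e2 : clifford V (pairing V e (a.1 w) • e') =
        pairing V e (a.1 w) • clifford V e' := by simp only [map_smul]
    have e3 : (-(pairing V e (a.1 w))) • clifford V e' =
        -(pairing V e (a.1 w) • clifford V e') := LinearMap.ext fun φ => by simp
    rw [e3] at h2'
    rw [e1, e2, ← h1', ← neg_neg (pairing V e (a.1 w) • clifford V e'), ← h2']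
    noncomm_ring
  set S : Module.End ℝ (Forms V) := ∑ i : Fin (Module.finrank ℝ V),
      (clifford V (a.1 (vec V (Module.finBasis ℝ V i))) *
          clifford V (covec V ((Module.finBasis ℝ V).coord i)) +
        clifford V (a.1 (covec V ((Module.finBasis ℝ V).coord i))) *
          clifford V (vec V (Module.finBasis ℝ V i))) with hS
  have hσ : spinRep V a = (1 / 2 : ℝ) • S := spinRep_apply V a
  have hmain : S * clifford V w - clifford V w * S =
      clifford V (a.1 w) + clifford V (a.1 w) := by
    rw [hS, Finset.sum_mul, Finset.mul_sum, ← Finset.sum_sub_distrib]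
    simp only [add_mul, mul_add, add_sub_add_comm, key]
    have e1 := congrArg (fun t => clifford V (a.1 t)) (sum_pairing V w)
    have e2 := congrArg (clifford V) (sum_pairing V (a.1 w))
    simp only [map_sum, map_add, Finset.sum_add_distrib] at e1 e2 ⊢
    rw [← sub_eq_zero] at e1 e2 ⊢
    rw [← add_zero (0 : Module.End ℝ (Forms V))]
    nth_rewrite 1 [← e1]
    rw [← e2]
    abel
  refine LinearMap.ext fun φ => ?_
  have h := LinearMap.congr_fun hmain φ
  rw [hσ]
  simp only [LinearMap.sub_apply, LinearMap.add_apply, Module.End.mul_apply,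
    LinearMap.smul_apply, map_smul] at h ⊢
  rw [← smul_sub, h, ← two_smul ℝ, smul_smul]
  norm_num

end Finite

section Spinors

variable (V K : Type*) [AddCommGroup V] [Module ℝ V] [AddCommGroup K] [Module ℝ K]

/-- The spinor space `Λ*V* ⊗ K`; here `K` stands for a square root of the line `Λ⁶V`. -/
abbrev Spinor : Type _ := Forms V ⊗[ℝ] K

/-- The half-spin space `S = Λᵉᵛ V* ⊗ K` inside `Λ*V* ⊗ K`; `CliffordAlgebra.evenOdd 0 0` is the
sum of the `ΛᵖV*` with `p` even. -/
def evenSpinors : Submodule ℝ (Spinor V K) :=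
  LinearMap.range
    ((CliffordAlgebra.evenOdd (0 : QuadraticForm ℝ (Module.Dual ℝ V)) 0).subtype.rTensor K)

/-- The bilinear form `(φ, ψ) ↦ (σφ ∧ ψ)₆` on `Λ*V*` with values in `Λ⁶V*`. Here `σ` is the
reversal antiautomorphism, which is `(-1)^m` in the degrees `2m` and `2m + 1`
(see `reverse_of_mem`). -/
def mukai : LinearMap.BilinMap ℝ (Forms V) (⋀[ℝ]^6 (Module.Dual ℝ V)) :=
  ((LinearMap.mul ℝ (Forms V)).compr₂
    ((DirectSum.component ℝ ℕ (fun i => ⋀[ℝ]^i (Module.Dual ℝ V)) 6) ∘ₗ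
      (DirectSum.decomposeLinearEquiv (fun i : ℕ => ⋀[ℝ]^i (Module.Dual ℝ V))).toLinearMap)) ∘ₗ
    (CliffordAlgebra.reverse (Q := (0 : QuadraticForm ℝ (Module.Dual ℝ V))))

theorem mukai_apply (φ ψ : Forms V) :
    mukai V φ ψ = DirectSum.decompose (fun i : ℕ => ⋀[ℝ]^i (Module.Dual ℝ V))
      ((CliffordAlgebra.reverse (Q := (0 : QuadraticForm ℝ (Module.Dual ℝ V))) φ : Forms V) * ψ)
      6 := rfl

variable {V} in
theorem mul_ι_of_mem {n : ℕ} {x : Forms V} (hx : x ∈ ⋀[ℝ]^n (Module.Dual ℝ V))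
    (ξ : Module.Dual ℝ V) :
    x * ExteriorAlgebra.ι ℝ ξ = (-1 : ℝ) ^ n • (ExteriorAlgebra.ι ℝ ξ * x) := by
  induction hx using Submodule.pow_induction_on_left' with
  | algebraMap r => simp [Algebra.commutes]
  | add x y i hx hy ihx ihy => rw [add_mul, mul_add, ihx, ihy, smul_add]
  | mem_mul m hm i x hx ih =>
    obtain ⟨η, rfl⟩ := hm
    have h : ExteriorAlgebra.ι ℝ η * ExteriorAlgebra.ι ℝ ξ =
        -(ExteriorAlgebra.ι ℝ ξ * ExteriorAlgebra.ι ℝ η) :=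
      eq_neg_of_add_eq_zero_left (ExteriorAlgebra.ι_add_mul_swap η ξ)
    rw [mul_assoc, ih, mul_smul_comm, ← mul_assoc, h, pow_succ, neg_mul, mul_assoc]
    simp

variable {V} in
theorem reverse_of_mem {n : ℕ} {x : Forms V} (hx : x ∈ ⋀[ℝ]^n (Module.Dual ℝ V)) :
    CliffordAlgebra.reverse (Q := (0 : QuadraticForm ℝ (Module.Dual ℝ V))) x =
      (-1 : ℝ) ^ (n / 2) • x := by
  induction hx using Submodule.pow_induction_on_left' with
  | algebraMap r => simp
  | add x y i hx hy ihx ihy => rw [map_add, ihx, ihy, smul_add]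
  | mem_mul m hm i x hx ih =>
    obtain ⟨η, rfl⟩ := hm
    have h1 : CliffordAlgebra.reverse (Q := (0 : QuadraticForm ℝ (Module.Dual ℝ V)))
        (ExteriorAlgebra.ι ℝ η * x) =
        CliffordAlgebra.reverse (Q := (0 : QuadraticForm ℝ (Module.Dual ℝ V))) x *
          ExteriorAlgebra.ι ℝ η := by
      rw [CliffordAlgebra.reverse.map_mul]
      congr 1
      exact CliffordAlgebra.reverse_ι η
    have h2 : (-1 : ℝ) ^ (i / 2) * (-1 : ℝ) ^ i = (-1 : ℝ) ^ ((i + 1) / 2) := by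
      rw [← pow_add]
      rcases Nat.even_or_odd' i with ⟨k, rfl | rfl⟩
      · rw [show (2 * k + 1) / 2 = k by omega, show 2 * k / 2 = k by omega, pow_add, pow_mul]
        simp
      · rw [show (2 * k + 1 + 1) / 2 = k + 1 by omega, show (2 * k + 1) / 2 = k by omega,
          show k + (2 * k + 1) = 2 * k + (k + 1) by ring, pow_add, pow_mul]
        simp
    rw [h1, ih, smul_mul_assoc, mul_ι_of_mem hx, smul_smul, h2]

variable {V K}

/-- The invariant bilinear form on spinors,
`⟨φ ⊗ k, ψ ⊗ l⟩ = (σφ ∧ ψ)₆ · s(k ⊗ l)`, where `s : K ⊗ K ≅ Λ⁶V` exhibits `K` as a square root of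
`Λ⁶V` and the dot is the natural pairing of `Λ⁶V* = (Λ⁶V)*` with `Λ⁶V`. -/
def form (s : K ⊗[ℝ] K ≃ₗ[ℝ] ⋀[ℝ]^6 V) : LinearMap.BilinForm ℝ (Spinor V K) :=
  (LinearMap.BilinMap.tmul (mukai V) (TensorProduct.mk ℝ K K)).compr₂
    (TensorProduct.lift ((exteriorPower.pairingDual ℝ V 6).compl₂ s.toLinearMap))

theorem form_tmul (s : K ⊗[ℝ] K ≃ₗ[ℝ] ⋀[ℝ]^6 V) (φ ψ : Forms V) (k l : K) :
    form s (φ ⊗ₜ k) (ψ ⊗ₜ l) = exteriorPower.pairingDual ℝ V 6 (mukai V φ ψ) (s (k ⊗ₜ l)) := rfl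

section Moment

variable [FiniteDimensional ℝ V]

/-- The linear function `a ↦ ½ ⟨σ(a)ρ, ρ⟩` on `𝔰𝔬(V ⊕ V*)`. -/
def momentFunctional (s : K ⊗[ℝ] K ≃ₗ[ℝ] ⋀[ℝ]^6 V) (ρ : Spinor V K) :
    Module.Dual ℝ (so V) :=
  (1 / 2 : ℝ) • ((form s).flip ρ ∘ₗ LinearMap.applyₗ (R := ℝ) ρ ∘ₗ
    LinearMap.rTensorHom K ∘ₗ spinRep V)

theorem momentFunctional_apply (s : K ⊗[ℝ] K ≃ₗ[ℝ] ⋀[ℝ]^6 V) (ρ : Spinor V K) (a : so V) :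
    momentFunctional s ρ a = 1 / 2 * form s ((spinRep V a).rTensor K ρ) ρ := rfl

/-- The moment map, with values in `𝔰𝔬(V ⊕ V*)`, identified with its dual by `tr(XY)`. -/
def moment (s : K ⊗[ℝ] K ≃ₗ[ℝ] ⋀[ℝ]^6 V) (ρ : Spinor V K) : so V :=
  ((traceForm V).toDual (traceForm_nondegenerate V)).symm (momentFunctional s ρ)

theorem trace_moment_mul (s : K ⊗[ℝ] K ≃ₗ[ℝ] ⋀[ℝ]^6 V) (ρ : Spinor V K) (a : so V) :
    LinearMap.trace ℝ (Doubled V) ((moment s ρ).1 * a.1) =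
      1 / 2 * form s ((spinRep V a).rTensor K ρ) ρ :=
  LinearMap.BilinForm.apply_toDual_symm_apply (hB := traceForm_nondegenerate V) _ _

/-- The quartic `q(ρ) = tr μ(ρ)²`. -/
def quartic (s : K ⊗[ℝ] K ≃ₗ[ℝ] ⋀[ℝ]^6 V) (ρ : Spinor V K) : ℝ :=
  LinearMap.trace ℝ (Doubled V) ((moment s ρ).1 * (moment s ρ).1)

end Moment

/-! Complex spinors are the elements of `ℂ ⊗ (Λ*V* ⊗ K)`. -/

/-- The complex-bilinear Clifford action of `(V ⊕ V*) ⊗ ℂ` on complex spinors. -/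
def cliffordC : (ℂ ⊗[ℝ] Doubled V) →ₗ[ℂ] Module.End ℂ (ℂ ⊗[ℝ] Spinor V K) :=
  LinearMap.liftBaseChange ℂ
    (LinearMap.baseChangeHom ℝ ℂ (Spinor V K) (Spinor V K) ∘ₗ
      LinearMap.rTensorHom K ∘ₗ clifford V)

theorem cliffordC_tmul (z y : ℂ) (w : Doubled V) (φ : Forms V) (k : K) :
    cliffordC (z ⊗ₜ w) (y ⊗ₜ (φ ⊗ₜ k) : ℂ ⊗[ℝ] Spinor V K) =
      (z * y) ⊗ₜ (clifford V w φ ⊗ₜ k) := by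
  simp [cliffordC, TensorProduct.smul_tmul']

/-- The annihilator `E_φ = {w ∈ (V ⊕ V*) ⊗ ℂ : w · φ = 0}` of a complex spinor. -/
def annihilator (φ : ℂ ⊗[ℝ] Spinor V K) : Submodule ℂ (ℂ ⊗[ℝ] Doubled V) :=
  LinearMap.ker (cliffordC.flip φ)

/-- A complex spinor in `S ⊗ ℂ` is pure if the dimension of its annihilator (which is isotropic
when the spinor is not zero) is that of `V`. -/
def IsPure (φ : ℂ ⊗[ℝ] Spinor V K) : Prop :=
  φ ∈ (evenSpinors V K).baseChange ℂ ∧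
    Module.finrank ℂ (annihilator φ) = Module.finrank ℝ V

/-- The complex-bilinear extension of the form `⟨ , ⟩`. -/
def formC (s : K ⊗[ℝ] K ≃ₗ[ℝ] ⋀[ℝ]^6 V) : LinearMap.BilinForm ℂ (ℂ ⊗[ℝ] Spinor V K) :=
  LinearMap.BilinForm.baseChange ℂ (form s)

/-- Complex conjugation `φ ↦ φ̄` on complex spinors. -/
def conj : (ℂ ⊗[ℝ] Spinor V K) →ₗ[ℝ] (ℂ ⊗[ℝ] Spinor V K) :=
  Complex.conjAe.toLinearMap.rTensor (Spinor V K)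

/-- The real part of a complex spinor. -/
def realPart : (ℂ ⊗[ℝ] Spinor V K) →ₗ[ℝ] Spinor V K :=
  (TensorProduct.lid ℝ (Spinor V K)).toLinearMap ∘ₗ Complex.reLm.rTensor (Spinor V K)

end Spinors

end SpinSix

end

open scoped TensorProduct

noncomputable section

namespace SpinSix

/-! ### Degrees and commutation rules for the Clifford action on forms -/

section CliffordModule

variable {V : Type*} [AddCommGroup V] [Module ℝ V]

/-! Write `ρ = r ⊗ k` with `k` a generator of the line `K`, let `B` be the resulting form on `Λ*V*`,
let `m` be the moment of `ρ` and `q = tr m²`. Testing the moment on the elements `wedge u w` gives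
`(m u, w) = ¼ B(u·w·r, r)`, where `(,)` is `pairing`.

The heart of the matter is a Fierz identity for two spinors of opposite parity in dimension six
(`fierzDefect_eq_zero`). Both sides are equivariant under Clifford multiplication by a nonisotropic
vector, so an induction on the degree of `x` reduces it to `x = 1` and `ρ` odd. There it is a
computation with the components of degrees 1, 3 and 5 (`vacuum_identity`).

Applied to an even `r` and to `x = u·r`, the identity becomes `3 (m u)·r = -u·σ(m) r` for all `u`
(`three_smul_clifford`). A second application of `σ(m)` gives `u·σ(m)² r = 9 (m² u)·r`, and
contraction over a basis of `V ⊕ V*` gives `σ(m)² r = ¾ q r`. Hence `(m² u - (q/12) u)·r = 0`. A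
vector that annihilates `r` lies in the kernel of `m`, so `m³ = (q/12) m`. If `q ≠ 0`, then `1 -
(12/q) m²` is an idempotent of trace `12 - 12 = 0`, so it vanishes and `m² = q/12`
(`IsMoment.sq_eq`).

If `q < 0`, write `q/12 = -c²`, so that `m/c` is a complex structure on `V ⊕ V*`. With `r' = -(3c)⁻¹
σ(m) r` the relations become `(m u)·r = c u·r'` and `(m u)·r' = -c u·r`. The annihilator of `φ = (r
+ i r') ⊗ k` is then the `ic`-eigenspace of `m`, of complex dimension six, so `φ` is pure. Finally
`⟨φ, φ̄⟩ = 2i B(r', r)` is a nonzero multiple of `B(σ(m) r, r) = 2q`. -/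

theorem clifford_vec (v : V) (x : Forms V) :
    clifford V (vec V v) x =
      CliffordAlgebra.contractLeft (Q := (0 : QuadraticForm ℝ (Module.Dual ℝ V)))
        (Module.Dual.eval ℝ V v) x := by
  rw [clifford_apply]
  change ExteriorAlgebra.ι ℝ (0 : Module.Dual ℝ V) * x + _ = _
  rw [map_zero, zero_mul, zero_add]
  rfl

theorem clifford_covec (ξ : Module.Dual ℝ V) (x : Forms V) :
    clifford V (covec V ξ) x = ExteriorAlgebra.ι ℝ ξ * x := by
  rw [clifford_apply]
  change _ + CliffordAlgebra.contractLeft (Q := (0 : QuadraticForm ℝ (Module.Dual ℝ V)))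
    (Module.Dual.eval ℝ V (0 : V)) x = _
  rw [map_zero, map_zero, LinearMap.zero_apply, add_zero]
  rfl

theorem clifford_vec_one (v : V) : clifford V (vec V v) 1 = 0 := by
  rw [clifford_vec, CliffordAlgebra.contractLeft_one]

theorem clifford_anticomm_apply (u w : Doubled V) (x : Forms V) :
    clifford V u (clifford V w x) + clifford V w (clifford V u x) = pairing V u w • x :=
  LinearMap.congr_fun (clifford_anticomm u w) x

theorem clifford_swap (u w : Doubled V) (x : Forms V) :
    clifford V u (clifford V w x) = pairing V u w • x - clifford V w (clifford V u x) :=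
  eq_sub_of_add_eq (clifford_anticomm_apply u w x)

theorem clifford_sq_apply (w : Doubled V) (x : Forms V) :
    clifford V w (clifford V w x) = w.1 w.2 • x :=
  LinearMap.congr_fun (clifford_sq V w) x

theorem pairing_self (w : Doubled V) : pairing V w w = 2 * w.1 w.2 := by
  rw [pairing_apply, two_mul]

theorem covec_mem {n : ℕ} {x : Forms V} (hx : x ∈ ⋀[ℝ]^n (Module.Dual ℝ V))
    (ξ : Module.Dual ℝ V) :
    clifford V (covec V ξ) x ∈ ⋀[ℝ]^(n + 1) (Module.Dual ℝ V) := by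
  rw [clifford_covec]
  change _ ∈ LinearMap.range (ExteriorAlgebra.ι ℝ) ^ (n + 1)
  rw [pow_succ']
  exact Submodule.mul_mem_mul ⟨ξ, rfl⟩ hx

theorem exists_smul_one_of_mem_zero {x : Forms V} (hx : x ∈ ⋀[ℝ]^0 (Module.Dual ℝ V)) :
    ∃ r : ℝ, x = r • 1 := by
  change x ∈ LinearMap.range (ExteriorAlgebra.ι ℝ) ^ 0 at hx
  rw [pow_zero, Submodule.mem_one] at hx
  obtain ⟨r, rfl⟩ := hx
  exact ⟨r, Algebra.algebraMap_eq_smul_one r⟩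

theorem exists_covec_of_mem_one {x : Forms V} (hx : x ∈ ⋀[ℝ]^1 (Module.Dual ℝ V)) :
    ∃ η : Module.Dual ℝ V, x = clifford V (covec V η) 1 := by
  change x ∈ LinearMap.range (ExteriorAlgebra.ι ℝ) ^ 1 at hx
  rw [pow_one] at hx
  obtain ⟨η, rfl⟩ := hx
  exact ⟨η, by rw [clifford_covec, mul_one]⟩

/-- Induction on the degree of a form, in terms of the Clifford action. -/
theorem forms_induction {p : ℕ → Forms V → Prop}
    (one : p 0 1) (add : ∀ n x y, p n x → p n y → p n (x + y))
    (smul : ∀ n (r : ℝ) x, p n x → p n (r • x))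
    (covec : ∀ n ξ x, x ∈ ⋀[ℝ]^n (Module.Dual ℝ V) → p n x →
      p (n + 1) (clifford V (covec V ξ) x))
    {n : ℕ} {x : Forms V} (hx : x ∈ ⋀[ℝ]^n (Module.Dual ℝ V)) : p n x := by
  induction hx using Submodule.pow_induction_on_left' with
  | algebraMap r => rw [Algebra.algebraMap_eq_smul_one]; exact smul _ _ _ one
  | add x y i hx hy ihx ihy => exact add _ _ _ ihx ihy
  | mem_mul m hm i x hx ih =>
    obtain ⟨η, rfl⟩ := hm
    rw [← clifford_covec]
    exact covec _ _ _ hx ih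

/-- In degree 0 the truncated `n - 1` is again 0, and mere membership would be too weak for the step
from degree 0 to degree 1. The vanishing clause repairs this. -/
theorem vec_mem_pred {n : ℕ} {x : Forms V} (hx : x ∈ ⋀[ℝ]^n (Module.Dual ℝ V)) (v : V) :
    (n = 0 → clifford V (vec V v) x = 0) ∧
      clifford V (vec V v) x ∈ ⋀[ℝ]^(n - 1) (Module.Dual ℝ V) := by
  refine forms_induction (p := fun n x => (n = 0 → clifford V (vec V v) x = 0) ∧
      clifford V (vec V v) x ∈ ⋀[ℝ]^(n - 1) (Module.Dual ℝ V)) ?_ ?_ ?_ ?_ hx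
  · simp [clifford_vec_one]
  · rintro n x y ⟨hx, hx'⟩ ⟨hy, hy'⟩
    refine ⟨fun h => by rw [map_add, hx h, hy h, add_zero], ?_⟩
    rw [map_add]
    exact add_mem hx' hy'
  · rintro n r x ⟨hx, hx'⟩
    refine ⟨fun h => by rw [map_smul, hx h, smul_zero], ?_⟩
    rw [map_smul]
    exact Submodule.smul_mem _ _ hx'
  · rintro n ξ x hx ⟨h0, h1⟩
    refine ⟨fun h => absurd h n.succ_ne_zero, ?_⟩
    rw [clifford_swap]
    refine sub_mem (Submodule.smul_mem _ _ hx) ?_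
    rcases n with _ | n
    · rw [h0 rfl, map_zero]
      exact zero_mem _
    · exact covec_mem h1 ξ

theorem vec_mem {n : ℕ} {x : Forms V} (hx : x ∈ ⋀[ℝ]^(n + 1) (Module.Dual ℝ V)) (v : V) :
    clifford V (vec V v) x ∈ ⋀[ℝ]^n (Module.Dual ℝ V) :=
  (vec_mem_pred hx v).2

theorem vec_of_mem_zero {x : Forms V} (hx : x ∈ ⋀[ℝ]^0 (Module.Dual ℝ V)) (v : V) :
    clifford V (vec V v) x = 0 :=
  (vec_mem_pred hx v).1 rfl

theorem vec_vec_of_mem_one {x : Forms V} (hx : x ∈ ⋀[ℝ]^1 (Module.Dual ℝ V)) (u v : V) :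
    clifford V (vec V u) (clifford V (vec V v) x) = 0 :=
  vec_of_mem_zero (vec_mem hx v) u

theorem vec_vec_swap (u v : V) (x : Forms V) :
    clifford V (vec V u) (clifford V (vec V v) x) =
      -clifford V (vec V v) (clifford V (vec V u) x) := by
  rw [clifford_swap, pairing_vec]
  change (0 : Module.Dual ℝ V) u • x - _ = _
  simp

end CliffordModule

/-! ### Dual bases of `V ⊕ V*`, contractions and the number operator -/

section Frame

variable (V : Type*) [AddCommGroup V] [Module ℝ V] [FiniteDimensional ℝ V]

/-- The basis of `V ⊕ V*` made of a basis of `V` and the dual basis of `V*`. -/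
def frame : Fin (Module.finrank ℝ V) ⊕ Fin (Module.finrank ℝ V) → Doubled V :=
  Sum.elim (fun i => vec V (Module.finBasis ℝ V i))
    (fun i => covec V ((Module.finBasis ℝ V).coord i))

/-- The basis of `V ⊕ V*` dual to `frame`. -/
def dualFrame (a : Fin (Module.finrank ℝ V) ⊕ Fin (Module.finrank ℝ V)) : Doubled V :=
  frame V a.swap

variable {V}

theorem sum_frame_swap {X : Type*} [AddCommMonoid X] (g : Doubled V → Doubled V → X) :
    ∑ a, g (dualFrame V a) (frame V a) = ∑ a, g (frame V a) (dualFrame V a) := by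
  refine Fintype.sum_equiv (Equiv.sumComm _ _) _ _ fun a => ?_
  cases a <;> rfl

theorem sum_pairing_dualFrame_smul_frame (w : Doubled V) :
    ∑ a, pairing V w (dualFrame V a) • frame V a = w := by
  conv_rhs => rw [← sum_pairing V w]
  rw [Fintype.sum_sum_type, ← Finset.sum_add_distrib]
  exact Finset.sum_congr rfl fun i _ => by
    rw [pairing_comm w, pairing_comm w]; rfl

theorem sum_pairing_frame_smul_dualFrame (w : Doubled V) :
    ∑ a, pairing V w (frame V a) • dualFrame V a = w := by
  rw [sum_frame_swap (fun u u' => pairing V w u' • u)]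
  exact sum_pairing_dualFrame_smul_frame w

/-- The element `∑ₐ fₐ ⊗ fᵃ` is canonical, so an operator on the first factor can be replaced by its
adjoint on the second. -/
theorem sum_frame_map {X : Type*} [AddCommGroup X] [Module ℝ X]
    (g : Doubled V →ₗ[ℝ] Doubled V →ₗ[ℝ] X) (A A' : Doubled V →ₗ[ℝ] Doubled V)
    (h : ∀ u w, pairing V (A u) w = pairing V u (A' w)) :
    ∑ a, g (A (frame V a)) (dualFrame V a) = ∑ a, g (frame V a) (A' (dualFrame V a)) := by
  have h1 : ∀ a, g (A (frame V a)) (dualFrame V a) =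
      ∑ b, pairing V (A (frame V a)) (dualFrame V b) • g (frame V b) (dualFrame V a) := by
    intro a
    conv_lhs => rw [← sum_pairing_dualFrame_smul_frame (A (frame V a))]
    simp
  have h2 : ∀ b, g (frame V b) (A' (dualFrame V b)) =
      ∑ a, pairing V (A (frame V a)) (dualFrame V b) • g (frame V b) (dualFrame V a) := by
    intro b
    conv_lhs => rw [← sum_pairing_frame_smul_dualFrame (A' (dualFrame V b))]
    simp [h, pairing_comm (A' _)]
  simp only [h1, h2]
  exact Finset.sum_comm

theorem trace_eq_sum_frame (A : Module.End ℝ (Doubled V)) :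
    LinearMap.trace ℝ (Doubled V) A = ∑ a, pairing V (frame V a) (A (dualFrame V a)) := by
  have h : A = ∑ a, (pairing V (frame V a)).smulRight (A (dualFrame V a)) := by
    refine LinearMap.ext fun w => ?_
    conv_lhs => rw [← sum_pairing_frame_smul_dualFrame w]
    simp [pairing_comm w]
  conv_lhs => rw [h]
  simp [LinearMap.trace_smulRight]

theorem finrank_doubled : Module.finrank ℝ (Doubled V) = 2 * Module.finrank ℝ V := by
  change Module.finrank ℝ (Module.Dual ℝ V × V) = _
  rw [Module.finrank_prod, Subspace.dual_finrank_eq, two_mul]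

theorem spinRep_eq_sum_frame (a : so V) (x : Forms V) :
    spinRep V a x = (1 / 2 : ℝ) • ∑ b, clifford V (a.1 (frame V b))
      (clifford V (dualFrame V b) x) := by
  rw [spinRep_apply, Fintype.sum_sum_type, ← Finset.sum_add_distrib]
  simp only [LinearMap.smul_apply, LinearMap.sum_apply, LinearMap.add_apply,
    Module.End.mul_apply]
  rfl

/-- For symmetric `S` the sum is unchanged when its two Clifford factors are exchanged, so it is
half of the sum of the anticommutators, which are the scalars `(fₐ, S fᵃ)`. -/
theorem sum_frame_anticomm (S : Module.End ℝ (Doubled V))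
    (h : ∀ u w, pairing V (S u) w = pairing V u (S w)) (x : Forms V) :
    ∑ a, clifford V (frame V a) (clifford V (S (dualFrame V a)) x) =
      (LinearMap.trace ℝ (Doubled V) S / 2) • x := by
  have h1 : ∑ a, clifford V (frame V a) (clifford V (S (dualFrame V a)) x) =
      ∑ a, clifford V (S (dualFrame V a)) (clifford V (frame V a) x) := by
    rw [sum_frame_swap (fun u w => clifford V (S u) (clifford V w x))]
    exact (sum_frame_map (LinearMap.mk₂ ℝ (fun u w => clifford V u (clifford V w x))
      (by simp) (by simp) (by simp) (by simp)) S S h).symm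
  have h2 : ∑ a, clifford V (frame V a) (clifford V (S (dualFrame V a)) x) +
      ∑ a, clifford V (S (dualFrame V a)) (clifford V (frame V a) x) =
      LinearMap.trace ℝ (Doubled V) S • x := by
    rw [← Finset.sum_add_distrib, trace_eq_sum_frame, Finset.sum_smul]
    exact Finset.sum_congr rfl fun a _ => clifford_anticomm_apply _ _ _
  rw [← h1, ← two_smul ℝ] at h2
  rw [div_eq_inv_mul, mul_smul, ← h2, smul_smul]
  norm_num

theorem sum_coord_smul (η : Module.Dual ℝ V) :
    ∑ i, η (Module.finBasis ℝ V i) • (Module.finBasis ℝ V).coord i = η :=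
  Module.Basis.sum_dual_apply_smul_coord _ _

/-- The number operator: `∑ᵢ eⁱ ∧ ι(eᵢ) x = n x` for `x` of degree `n`. -/
theorem sum_covec_vec {n : ℕ} {x : Forms V} (hx : x ∈ ⋀[ℝ]^n (Module.Dual ℝ V)) :
    ∑ i, clifford V (covec V ((Module.finBasis ℝ V).coord i))
      (clifford V (vec V (Module.finBasis ℝ V i)) x) = (n : ℝ) • x := by
  refine forms_induction (p := fun n x => ∑ i, clifford V
    (covec V ((Module.finBasis ℝ V).coord i))
      (clifford V (vec V (Module.finBasis ℝ V i)) x) = (n : ℝ) • x) ?_ ?_ ?_ ?_ hx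
  · simp [clifford_vec_one]
  · intro n x y hx hy
    simp only [map_add, Finset.sum_add_distrib, hx, hy, smul_add]
  · intro n r x hx
    simp only [map_smul, ← Finset.smul_sum, hx, smul_comm r]
  · intro n ξ x _ ih
    have h : ∀ i, clifford V (covec V ((Module.finBasis ℝ V).coord i))
        (clifford V (vec V (Module.finBasis ℝ V i)) (clifford V (covec V ξ) x)) =
        clifford V (covec V (ξ (Module.finBasis ℝ V i) • (Module.finBasis ℝ V).coord i)) x +
        clifford V (covec V ξ) (clifford V (covec V ((Module.finBasis ℝ V).coord i))
          (clifford V (vec V (Module.finBasis ℝ V i)) x)) := by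
      intro i
      rw [clifford_swap (vec V _) (covec V ξ), map_sub,
        clifford_swap (covec V ((Module.finBasis ℝ V).coord i)) (covec V ξ), pairing_vec,
        pairing_covec]
      change _ - (((Module.finBasis ℝ V).coord i) 0 • _ - _) = _
      simp only [map_zero, zero_smul, zero_sub, sub_neg_eq_add, map_smul, LinearMap.smul_apply]
      rfl
    simp only [h, Finset.sum_add_distrib, ← map_sum, ih]
    rw [← LinearMap.sum_apply, ← map_sum, ← map_sum, sum_coord_smul, map_smul]
    push_cast
    rw [add_smul, one_smul, add_comm]

theorem sum_vec_covec {n : ℕ} {x : Forms V} (hx : x ∈ ⋀[ℝ]^n (Module.Dual ℝ V)) :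
    ∑ i, clifford V (vec V (Module.finBasis ℝ V i))
      (clifford V (covec V ((Module.finBasis ℝ V).coord i)) x) =
      ((Module.finrank ℝ V : ℝ) - n) • x := by
  have h : ∀ i, clifford V (vec V (Module.finBasis ℝ V i))
      (clifford V (covec V ((Module.finBasis ℝ V).coord i)) x) =
      x - clifford V (covec V ((Module.finBasis ℝ V).coord i))
      (clifford V (vec V (Module.finBasis ℝ V i)) x) := by
    intro i
    rw [clifford_swap, pairing_vec]
    change ((Module.finBasis ℝ V).coord i) _ • _ - _ = _
    simp
  simp only [h, Finset.sum_sub_distrib, sum_covec_vec hx, sub_smul]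
  simp [Nat.cast_smul_eq_nsmul]

end Frame

/-! ### Invariant forms on spinors, and the Fierz identity at the vacuum -/

section SpinorForm

variable {V : Type*} [AddCommGroup V] [Module ℝ V]

/-- The properties of the invariant form on the spinors of a six-dimensional space. -/
structure IsSpinorForm (B : LinearMap.BilinForm ℝ (Forms V)) : Prop where
  adjoint : ∀ w x y, B (clifford V w x) y = B x (clifford V w y)
  skew : ∀ x y, B x y = -B y x
  degree : ∀ {p q : ℕ} {x y : Forms V}, x ∈ ⋀[ℝ]^p (Module.Dual ℝ V) →
    y ∈ ⋀[ℝ]^q (Module.Dual ℝ V) → p + q ≠ 6 → B x y = 0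

theorem linearMap_ext_homogeneous {X : Type*} [AddCommMonoid X] [Module ℝ X]
    {f g : Forms V →ₗ[ℝ] X}
    (h : ∀ n, ∀ x ∈ ⋀[ℝ]^n (Module.Dual ℝ V), f x = g x) : f = g := by
  refine LinearMap.ext fun x => ?_
  induction x using DirectSum.Decomposition.inductionOn
    (fun i : ℕ => ⋀[ℝ]^i (Module.Dual ℝ V)) with
  | zero => simp
  | homogeneous x => exact h _ _ x.2
  | add x y hx hy => rw [map_add, map_add, hx, hy]

namespace IsSpinorForm

variable {B : LinearMap.BilinForm ℝ (Forms V)}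

theorem self_eq_zero (hB : IsSpinorForm B) (x : Forms V) : B x x = 0 := by
  have := hB.skew x x
  linarith

theorem clifford_clifford_swap (hB : IsSpinorForm B) (u w : Doubled V) (x : Forms V) :
    B (clifford V u (clifford V w x)) x = -B (clifford V w (clifford V u x)) x := by
  rw [hB.adjoint, hB.adjoint, hB.skew]

/-- Covectors generate all forms from `1` and can be moved to the other argument of `B`. -/
theorem eq_zero_of_one (hB : IsSpinorForm B) (h : ∀ y, B 1 y = 0) : B = 0 := by
  refine linearMap_ext_homogeneous fun n x hx => LinearMap.ext fun y => ?_
  revert y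
  refine forms_induction (p := fun _ x => ∀ y, B x y = (0 : LinearMap.BilinForm ℝ (Forms V)) x y)
    ?_ ?_ ?_ ?_ hx
  · simpa using h
  · intro n x y hx hy z
    simp [hx, hy]
  · intro n r x hx z
    simp [hx]
  · intro n ξ x _ ih z
    rw [hB.adjoint, ih]
    simp

variable [FiniteDimensional ℝ V]

/-- The radical of `B` is stable under contraction, so by induction all contractions of `x` vanish,
and the number operator then gives `n x = 0`. In degree 0 a nonzero scalar in the radical would
force `B = 0`. -/
theorem eq_zero_of_homogeneous (hB : IsSpinorForm B) (hne : B ≠ 0) {n : ℕ} {x : Forms V}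
    (hx : x ∈ ⋀[ℝ]^n (Module.Dual ℝ V)) (h : ∀ y, B x y = 0) : x = 0 := by
  induction n generalizing x with
  | zero =>
    obtain ⟨r, rfl⟩ := exists_smul_one_of_mem_zero hx
    by_cases hr : r = 0
    · rw [hr, zero_smul]
    · exact absurd (hB.eq_zero_of_one fun y => by simpa [hr] using h y) hne
  | succ n ih =>
    have h1 := sum_covec_vec hx
    have h2 : ∀ v, clifford V (vec V v) x = 0 := fun v =>
      ih (vec_mem hx v) fun y => by rw [hB.adjoint, h]
    simp only [h2, map_zero, Finset.sum_const_zero] at h1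
    exact (smul_eq_zero.1 h1.symm).resolve_left (by positivity)

end IsSpinorForm

theorem eq_zero_of_finrank_lt [FiniteDimensional ℝ V] {n : ℕ} (hn : Module.finrank ℝ V < n)
    {x : Forms V} (hx : x ∈ ⋀[ℝ]^n (Module.Dual ℝ V)) : x = 0 := by
  have h : Module.finrank ℝ (⋀[ℝ]^n (Module.Dual ℝ V)) = 0 := by
    rw [exteriorPower.finrank_eq, Subspace.dual_finrank_eq, Nat.choose_eq_zero_of_lt hn]
  rw [Submodule.finrank_eq_zero] at h
  rw [h] at hx
  exact (Submodule.mem_bot ℝ).1 hx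

theorem exists_odd_components [FiniteDimensional ℝ V] (hV : Module.finrank ℝ V = 6)
    {x : Forms V}
    (hx : x ∈ CliffordAlgebra.evenOdd (0 : QuadraticForm ℝ (Module.Dual ℝ V)) 1) :
    ∃ x₁ ∈ ⋀[ℝ]^1 (Module.Dual ℝ V), ∃ x₃ ∈ ⋀[ℝ]^3 (Module.Dual ℝ V),
      ∃ x₅ ∈ ⋀[ℝ]^5 (Module.Dual ℝ V), x = x₁ + x₃ + x₅ := by
  refine Submodule.iSup_induction _ (motive := fun x => ∃ x₁ ∈ ⋀[ℝ]^1 (Module.Dual ℝ V),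
    ∃ x₃ ∈ ⋀[ℝ]^3 (Module.Dual ℝ V), ∃ x₅ ∈ ⋀[ℝ]^5 (Module.Dual ℝ V), x = x₁ + x₃ + x₅) hx
    ?_ ?_ ?_
  · rintro ⟨n, hn⟩ x hx
    change x ∈ ⋀[ℝ]^n (Module.Dual ℝ V) at hx
    have hodd : n % 2 = 1 := by
      have := (ZMod.natCast_eq_natCast_iff n 1 2).1 (by simpa using hn)
      simpa [Nat.ModEq] using this
    by_cases h6 : 6 < n
    · rw [eq_zero_of_finrank_lt (hV ▸ h6) hx]
      exact ⟨0, zero_mem _, 0, zero_mem _, 0, zero_mem _, by simp⟩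
    · obtain rfl | rfl | rfl : n = 1 ∨ n = 3 ∨ n = 5 := by omega
      · exact ⟨x, hx, 0, zero_mem _, 0, zero_mem _, by simp⟩
      · exact ⟨0, zero_mem _, x, hx, 0, zero_mem _, by simp⟩
      · exact ⟨0, zero_mem _, 0, zero_mem _, x, hx, by simp⟩
  · exact ⟨0, zero_mem _, 0, zero_mem _, 0, zero_mem _, by simp⟩
  · rintro _ _ ⟨x₁, h₁, x₃, h₃, x₅, h₅, rfl⟩ ⟨y₁, k₁, y₃, k₃, y₅, k₅, rfl⟩
    exact ⟨_, add_mem h₁ k₁, _, add_mem h₃ k₃, _, add_mem h₅ k₅, by abel⟩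

theorem clifford_mem_evenOdd {i : ZMod 2} {x : Forms V}
    (hx : x ∈ CliffordAlgebra.evenOdd (0 : QuadraticForm ℝ (Module.Dual ℝ V)) i)
    (w : Doubled V) :
    clifford V w x ∈ CliffordAlgebra.evenOdd (0 : QuadraticForm ℝ (Module.Dual ℝ V)) (i + 1) := by
  refine Submodule.iSup_induction _ (motive := fun x => clifford V w x ∈
    CliffordAlgebra.evenOdd (0 : QuadraticForm ℝ (Module.Dual ℝ V)) (i + 1)) hx ?_ ?_ ?_
  · rintro ⟨n, hn⟩ x hx
    change x ∈ ⋀[ℝ]^n (Module.Dual ℝ V) at hx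
    have key : ∀ m : ℕ, (m : ZMod 2) = i + 1 → ∀ y ∈ ⋀[ℝ]^m (Module.Dual ℝ V),
        y ∈ CliffordAlgebra.evenOdd (0 : QuadraticForm ℝ (Module.Dual ℝ V)) (i + 1) :=
      fun m hm y hy => Submodule.mem_iSup_of_mem (⟨m, hm⟩ : {n : ℕ // (n : ZMod 2) = i + 1}) hy
    rw [← covec_add_vec w, map_add, LinearMap.add_apply]
    refine add_mem (key (n + 1) (by rw [← hn]; push_cast; rfl) _ (covec_mem hx _)) ?_
    rcases n with _ | n
    · rw [vec_of_mem_zero hx]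
      exact zero_mem _
    · refine key n ?_ _ (vec_mem hx _)
      rw [← hn]
      push_cast
      rw [add_assoc, show (1 + 1 : ZMod 2) = 0 from rfl, add_zero]
  · rw [map_zero]
    exact zero_mem _
  · intro x y hx hy
    rw [map_add]
    exact add_mem hx hy

/-- The defect in the Fierz identity
`4 ∑ₐ B(ρ, fᵃ x) fₐ ρ = - ∑ₐᵦ B(fₐ fᵦ ρ, ρ) fᵇ fᵃ x`. -/
def fierzDefect [FiniteDimensional ℝ V] (B : LinearMap.BilinForm ℝ (Forms V)) (ρ x : Forms V) :
    Forms V :=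
  (4 : ℝ) • ∑ a, B ρ (clifford V (dualFrame V a) x) • clifford V (frame V a) ρ +
    ∑ a, ∑ b, B (clifford V (frame V a) (clifford V (frame V b) ρ)) ρ •
      clifford V (dualFrame V b) (clifford V (dualFrame V a) x)

namespace IsSpinorForm

variable {B : LinearMap.BilinForm ℝ (Forms V)}
variable [FiniteDimensional ℝ V]

/-- In the odd spinor `ρ`, the degree five component is dual to a vector `v`, and the Fierz
identity at the vacuum says that `-4 ι(v) ρ` is the quadratic expression below. -/
theorem vacuum_identity (hB : IsSpinorForm B) (hne : B ≠ 0) (hV : Module.finrank ℝ V = 6) {ρ : Forms V}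
    (hρ : ρ ∈ CliffordAlgebra.evenOdd (0 : QuadraticForm ℝ (Module.Dual ℝ V)) 1)
    {v : V} (hv : ∀ η, B ρ (clifford V (covec V η) 1) = η v) :
    ∑ i, ∑ j, B (clifford V (vec V (Module.finBasis ℝ V i))
        (clifford V (vec V (Module.finBasis ℝ V j)) ρ)) ρ •
          clifford V (covec V ((Module.finBasis ℝ V).coord j))
            (clifford V (covec V ((Module.finBasis ℝ V).coord i)) (1 : Forms V)) +
      (∑ i, B (clifford V (vec V (Module.finBasis ℝ V i))
        (clifford V (covec V ((Module.finBasis ℝ V).coord i)) ρ)) ρ) • (1 : Forms V) =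
      -(4 : ℝ) • clifford V (vec V v) ρ := by
  obtain ⟨x₁, h₁, x₃, h₃, x₅, h₅, rfl⟩ := exists_odd_components hV hρ
  have hv1 : ∀ y ∈ ⋀[ℝ]^1 (Module.Dual ℝ V), clifford V (vec V v) y = B x₅ y • 1 := by
    intro y hy
    have e1 := hB.degree h₁ hy (by norm_num)
    have e3 := hB.degree h₃ hy (by norm_num)
    obtain ⟨η, rfl⟩ := exists_covec_of_mem_one hy
    have e := hv η
    simp only [map_add, LinearMap.add_apply, e1, e3, zero_add] at e
    rw [clifford_swap, clifford_vec_one, map_zero, sub_zero, pairing_vec, e]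
    rfl
  -- By degree, only a `y` of degree 2 can pair with `ι(v) x₅`. There `B(ι(v) x₅, y) = B(x₅, ι(v)
  -- y)`, which by `hv1` is the scalar `ι(v) ι(v) y = 0`.
  have hv5 : clifford V (vec V v) x₅ = 0 := by
    refine hB.eq_zero_of_homogeneous hne (vec_mem h₅ v) fun y => ?_
    have : B (clifford V (vec V v) x₅) = 0 := linearMap_ext_homogeneous fun n y hy => by
      rw [LinearMap.zero_apply]
      by_cases hn : n = 2
      · subst hn
        rw [hB.adjoint]
        have e := hv1 _ (vec_mem hy v)
        rw [clifford_sq_apply] at e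
        have hz : (vec V v).1 (vec V v).2 = 0 := rfl
        rw [hz, zero_smul] at e
        have e' := congrArg ExteriorAlgebra.algebraMapInv e
        simpa using e'.symm
      · exact hB.degree (vec_mem h₅ v) hy (by omega)
    rw [this, LinearMap.zero_apply]
  have hα := vec_mem h₃ v
  -- The operator `∑ eᵢ·eⁱ·` multiplies degrees 1, 3, 5 by 5, 3, 1. Only degrees 1 and 5 pair
  -- nontrivially, since `B(x₃, x₃) = 0`, and skewness leaves `5 B(x₁, x₅) + B(x₅, x₁) = -4 B(x₅,
  -- x₁)`.
  have hscal : (∑ i, B (clifford V (vec V (Module.finBasis ℝ V i))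
        (clifford V (covec V ((Module.finBasis ℝ V).coord i)) (x₁ + x₃ + x₅)))
          (x₁ + x₃ + x₅)) • (1 : Forms V) = -(4 : ℝ) • clifford V (vec V v) x₁ := by
    rw [← LinearMap.sum_apply, ← map_sum]
    simp only [map_add, Finset.sum_add_distrib, sum_vec_covec h₁, sum_vec_covec h₃,
      sum_vec_covec h₅, hV, map_smul, LinearMap.add_apply, LinearMap.smul_apply]
    rw [hB.degree h₁ h₁ (by norm_num), hB.degree h₁ h₃ (by norm_num),
      hB.degree h₃ h₁ (by norm_num), hB.degree h₃ h₅ (by norm_num),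
      hB.degree h₅ h₃ (by norm_num), hB.degree h₅ h₅ (by norm_num), hB.self_eq_zero x₃,
      hB.skew x₁ x₅, hv1 x₁ h₁, smul_smul]
    congr 1
    simp only [smul_eq_mul]
    push_cast
    ring
  -- The pairings of `x₃` with `x₅` and of `x₅` with `x₃` contribute equally, whence the factor 2.
  -- The pairing of `x₅` with a one-form is contraction with `v`.
  have hcoef : ∀ i j, B (clifford V (vec V (Module.finBasis ℝ V i))
        (clifford V (vec V (Module.finBasis ℝ V j)) (x₁ + x₃ + x₅))) (x₁ + x₃ + x₅) •
          (1 : Forms V) =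
      -(2 : ℝ) • clifford V (vec V (Module.finBasis ℝ V i))
        (clifford V (vec V (Module.finBasis ℝ V j)) (clifford V (vec V v) x₃)) := by
    intro i j
    set a := Module.finBasis ℝ V i
    set b := Module.finBasis ℝ V j
    have k3 := vec_mem (vec_mem h₃ b) a
    have k5 := vec_mem (vec_mem h₅ b) a
    have e53 : B (clifford V (vec V a) (clifford V (vec V b) x₅)) x₃ =
        -B x₅ (clifford V (vec V a) (clifford V (vec V b) x₃)) := by
      rw [hB.adjoint, hB.adjoint, vec_vec_swap, map_neg]
    have e35 : B (clifford V (vec V a) (clifford V (vec V b) x₃)) x₅ =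
        -B x₅ (clifford V (vec V a) (clifford V (vec V b) x₃)) := hB.skew _ _
    simp only [map_add, vec_vec_of_mem_one h₁, zero_add, LinearMap.add_apply]
    rw [hB.degree k3 h₁ (by norm_num), hB.degree k5 h₁ (by norm_num),
      hB.degree k3 h₃ (by norm_num), hB.degree k5 h₅ (by norm_num), e53, e35]
    rw [vec_vec_swap b v, map_neg, vec_vec_swap a v, neg_neg, hv1 _ k3, smul_smul]
    congr 1
    ring
  -- The double sum applies the number operator in degree 1 and then in degree 2 to the two-form
  -- `ι(v) x₃`: a factor `1 · 2`, times the `-2` of `hcoef`.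
  have hquad : ∑ i, ∑ j, B (clifford V (vec V (Module.finBasis ℝ V i))
        (clifford V (vec V (Module.finBasis ℝ V j)) (x₁ + x₃ + x₅))) (x₁ + x₃ + x₅) •
          clifford V (covec V ((Module.finBasis ℝ V).coord j))
            (clifford V (covec V ((Module.finBasis ℝ V).coord i)) (1 : Forms V)) =
      -(4 : ℝ) • clifford V (vec V v) x₃ := by
    simp only [← map_smul, hcoef]
    simp only [map_smul, ← Finset.smul_sum]
    rw [Finset.sum_comm]
    simp only [← map_sum, sum_covec_vec (vec_mem hα _)]
    simp only [Nat.cast_one, one_smul, sum_covec_vec hα]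
    rw [smul_smul]
    norm_num
  rw [hquad, hscal, map_add, map_add, hv5]
  module

/-- Vectors kill `1`, so only `fᵃ = eⁱ` survives. In the quadratic sum `fᵇ = eʲ` gives the two-form
part, and `fᵇ = eⱼ` contracts with `eⁱ` to the scalar part. -/
theorem fierzDefect_one (hB : IsSpinorForm B) (hne : B ≠ 0) (hV : Module.finrank ℝ V = 6) {ρ : Forms V}
    (hρ : ρ ∈ CliffordAlgebra.evenOdd (0 : QuadraticForm ℝ (Module.Dual ℝ V)) 1) :
    fierzDefect B ρ 1 = 0 := by
  set v : V := ∑ i, B ρ (clifford V (covec V ((Module.finBasis ℝ V).coord i)) 1) •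
    Module.finBasis ℝ V i with hvdef
  have hv : ∀ η, B ρ (clifford V (covec V η) 1) = η v := by
    intro η
    conv_lhs => rw [← sum_coord_smul η]
    simp only [hvdef, map_sum, map_smul, LinearMap.sum_apply, LinearMap.smul_apply, smul_eq_mul]
    exact Finset.sum_congr rfl fun i _ => mul_comm _ _
  have h1 : ∑ a, B ρ (clifford V (dualFrame V a) 1) • clifford V (frame V a) ρ =
      clifford V (vec V v) ρ := by
    rw [Fintype.sum_sum_type]
    have z : ∀ i, clifford V (dualFrame V (Sum.inr i)) (1 : Forms V) = 0 :=
      fun i => clifford_vec_one _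
    simp only [z, map_zero, zero_smul, Finset.sum_const_zero, add_zero, hvdef, map_sum, map_smul,
      LinearMap.sum_apply, LinearMap.smul_apply]
    rfl
  have h2 : ∀ i, ∑ j, B (clifford V (frame V (Sum.inl i))
      (clifford V (frame V (Sum.inr j)) ρ)) ρ • clifford V (dualFrame V (Sum.inr j))
        (clifford V (dualFrame V (Sum.inl i)) (1 : Forms V)) =
      B (clifford V (vec V (Module.finBasis ℝ V i))
        (clifford V (covec V ((Module.finBasis ℝ V).coord i)) ρ)) ρ • (1 : Forms V) := by
    intro i
    have h3 : ∀ j, clifford V (dualFrame V (Sum.inr j))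
        (clifford V (dualFrame V (Sum.inl i)) (1 : Forms V)) =
        (if i = j then (1 : ℝ) else 0) • (1 : Forms V) := by
      intro j
      change clifford V (vec V (Module.finBasis ℝ V j))
        (clifford V (covec V ((Module.finBasis ℝ V).coord i)) 1) = _
      rw [clifford_swap, clifford_vec_one, map_zero, sub_zero, pairing_vec]
      change ((Module.finBasis ℝ V).coord i) _ • _ = _
      rw [Module.Basis.coord_apply, Module.Basis.repr_self, Finsupp.single_apply]
      simp only [eq_comm]
    simp only [h3]
    simp
    rfl
  have h4 := hB.vacuum_identity hne hV hρ hv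
  rw [fierzDefect, h1, Fintype.sum_sum_type]
  have z : ∀ i, clifford V (dualFrame V (Sum.inr i)) (1 : Forms V) = 0 :=
    fun i => clifford_vec_one _
  simp only [z, map_zero, smul_zero, Finset.sum_const_zero, add_zero]
  simp only [Fintype.sum_sum_type, h2, Finset.sum_add_distrib, ← Finset.sum_smul]
  change _ + (∑ i, ∑ j, B (clifford V (vec V (Module.finBasis ℝ V i))
        (clifford V (vec V (Module.finBasis ℝ V j)) ρ)) ρ •
          clifford V (covec V ((Module.finBasis ℝ V).coord j))
            (clifford V (covec V ((Module.finBasis ℝ V).coord i)) (1 : Forms V)) + _) = 0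
  rw [h4, ← add_smul]
  norm_num

end IsSpinorForm

end SpinorForm

/-! ### Equivariance of the Fierz identity and its proof in general -/

section Fierz

variable {V : Type*} [AddCommGroup V] [Module ℝ V] {B : LinearMap.BilinForm ℝ (Forms V)}

/-- The map `u ↦ w u w` on `V ⊕ V*`, computed in the Clifford algebra. -/
def conjugation (w : Doubled V) : Module.End ℝ (Doubled V) :=
  (pairing V w).smulRight w - w.1 w.2 • 1

theorem clifford_conjugation (w u : Doubled V) (x : Forms V) :
    clifford V (conjugation w u) x = clifford V w (clifford V u (clifford V w x)) := by
  rw [clifford_swap w u, clifford_sq_apply]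
  simp [conjugation]

theorem pairing_conjugation (w u u' : Doubled V) :
    pairing V (conjugation w u) u' = pairing V u (conjugation w u') := by
  simp [conjugation, pairing_comm u w, mul_comm]

theorem pairing_sq (m : so V) (u w : Doubled V) :
    pairing V ((m.1 * m.1) u) w = pairing V u ((m.1 * m.1) w) := by
  have h := (mem_so_iff m.1).1 m.2
  rw [Module.End.mul_apply, Module.End.mul_apply, h, h, neg_neg]

/-- `m` is the moment of the spinor `ρ` for the form `B`. -/
def IsMoment (B : LinearMap.BilinForm ℝ (Forms V)) (ρ : Forms V) (m : so V) : Prop :=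
  ∀ u w, pairing V (m.1 u) w = 1 / 4 * B (clifford V u (clifford V w ρ)) ρ

/-- `(m w, u)` is a multiple of `B(w·u·ρ, ρ) = -B(u·w·ρ, ρ)`. -/
theorem IsMoment.eq_zero_of_clifford {ρ : Forms V} {m : so V} (hm : IsMoment B ρ m) (hB : IsSpinorForm B) {w : Doubled V}
    (hw : clifford V w ρ = 0) : m.1 w = 0 := by
  refine eq_zero_of_pairing _ fun u => ?_
  rw [pairing_comm, hm, hB.clifford_clifford_swap, hw, map_zero]
  simp

variable [FiniteDimensional ℝ V]

theorem sum_pairing_dualFrame_smul_map {X : Type*} [AddCommGroup X] [Module ℝ X]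
    (g : Doubled V →ₗ[ℝ] X) (w : Doubled V) :
    ∑ a, pairing V w (dualFrame V a) • g (frame V a) = g w := by
  conv_rhs => rw [← sum_pairing_dualFrame_smul_frame w]
  simp only [map_sum, map_smul]

theorem sum_pairing_frame_smul_map {X : Type*} [AddCommGroup X] [Module ℝ X]
    (g : Doubled V →ₗ[ℝ] X) (w : Doubled V) :
    ∑ a, pairing V w (frame V a) • g (dualFrame V a) = g w := by
  conv_rhs => rw [← sum_pairing_frame_smul_dualFrame w]
  simp only [map_sum, map_smul]

namespace IsSpinorForm

theorem sum_linear_clifford (hB : IsSpinorForm B) (w : Doubled V) (ρ x : Forms V) :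
    ∑ a, B (clifford V w ρ) (clifford V (dualFrame V a) (clifford V w x)) •
        clifford V (frame V a) (clifford V w ρ) =
      w.1 w.2 • clifford V w
        (∑ a, B ρ (clifford V (dualFrame V a) x) • clifford V (frame V a) ρ) := by
  have h : ∀ a, B (clifford V w ρ) (clifford V (dualFrame V a) (clifford V w x)) •
        clifford V (frame V a) (clifford V w ρ) =
      (B ρ (clifford V w x)) • (pairing V w (dualFrame V a) • pairing V w (frame V a) • ρ) -
      (B ρ (clifford V w x)) •
        clifford V w (pairing V w (dualFrame V a) • clifford V (frame V a) ρ) -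
      (w.1 w.2) • ((pairing V w (frame V a) • B ρ (clifford V (dualFrame V a) x)) • ρ) +
      (w.1 w.2) • clifford V w
        (B ρ (clifford V (dualFrame V a) x) • clifford V (frame V a) ρ) := by
    intro a
    rw [hB.adjoint, clifford_swap w (dualFrame V a), clifford_sq_apply,
      clifford_swap (frame V a) w, pairing_comm (frame V a) w]
    simp only [map_sub, map_smul, smul_eq_mul]
    module
  simp only [h, Finset.sum_add_distrib, Finset.sum_sub_distrib, ← Finset.smul_sum, ← map_sum,
    ← Finset.sum_smul]
  have e1 := sum_pairing_dualFrame_smul_map ((pairing V w).smulRight ρ) w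
  have e2 := sum_pairing_dualFrame_smul_map ((clifford V).flip ρ) w
  have e3 := sum_pairing_frame_smul_map (B ρ ∘ₗ (clifford V).flip x) w
  simp only [LinearMap.smulRight_apply, LinearMap.flip_apply, LinearMap.comp_apply] at e1 e2 e3
  -- As `(w, w)` is twice the scalar `w²`, the first three sums are `2`, `-1` and `-1` times `w²
  -- B(ρ, w·x) ρ` and cancel.
  rw [e1, e2, e3, clifford_sq_apply, pairing_self]
  module

theorem sum_quadratic_clifford (hB : IsSpinorForm B) (w : Doubled V) (hw : w.1 w.2 ≠ 0)
    (ρ x : Forms V) :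
    ∑ a, ∑ b, B (clifford V (frame V a) (clifford V (frame V b) (clifford V w ρ)))
        (clifford V w ρ) •
          clifford V (dualFrame V b) (clifford V (dualFrame V a) (clifford V w x)) =
      w.1 w.2 • clifford V w
        (∑ a, ∑ b, B (clifford V (frame V a) (clifford V (frame V b) ρ)) ρ •
          clifford V (dualFrame V b) (clifford V (dualFrame V a) x)) := by
  have h1 : ∀ u u', w.1 w.2 * B (clifford V u (clifford V u' (clifford V w ρ)))
      (clifford V w ρ) =
      B (clifford V (conjugation w u) (clifford V (conjugation w u') ρ)) ρ := by
    intro u u'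
    rw [clifford_conjugation, clifford_conjugation, clifford_sq_apply, hB.adjoint w,
      map_smul, map_smul, LinearMap.smul_apply, smul_eq_mul]
  have h2 : ∀ u u', clifford V (conjugation w u') (clifford V (conjugation w u)
      (clifford V w x)) = (w.1 w.2 * w.1 w.2) • clifford V w (clifford V u' (clifford V u x)) := by
    intro u u'
    rw [clifford_conjugation, clifford_conjugation, clifford_sq_apply, clifford_sq_apply]
    simp only [map_smul, smul_smul]
  have h3 : ∀ a, ∑ b, B (clifford V (conjugation w (frame V a))
      (clifford V (conjugation w (frame V b)) ρ)) ρ •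
        clifford V (dualFrame V b) (clifford V (dualFrame V a) (clifford V w x)) =
      ∑ b, B (clifford V (conjugation w (frame V a)) (clifford V (frame V b) ρ)) ρ •
        clifford V (conjugation w (dualFrame V b))
          (clifford V (dualFrame V a) (clifford V w x)) := fun a =>
    sum_frame_map (LinearMap.mk₂ ℝ (fun u u' => B (clifford V (conjugation w (frame V a))
      (clifford V u ρ)) ρ • clifford V u' (clifford V (dualFrame V a) (clifford V w x)))
      (by simp [add_smul]) (by simp [mul_smul]) (by simp) (fun _ _ _ => by rw [map_smul, LinearMap.smul_apply, smul_comm]))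
      (conjugation w) (conjugation w) (pairing_conjugation w)
  have h4 : ∀ b, ∑ a, B (clifford V (conjugation w (frame V a))
      (clifford V (frame V b) ρ)) ρ • clifford V (conjugation w (dualFrame V b))
          (clifford V (dualFrame V a) (clifford V w x)) =
      ∑ a, B (clifford V (frame V a) (clifford V (frame V b) ρ)) ρ •
        clifford V (conjugation w (dualFrame V b))
          (clifford V (conjugation w (dualFrame V a)) (clifford V w x)) := fun b =>
    sum_frame_map (LinearMap.mk₂ ℝ (fun u u' => B (clifford V u
      (clifford V (frame V b) ρ)) ρ • clifford V (conjugation w (dualFrame V b))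
        (clifford V u' (clifford V w x)))
      (by simp [add_smul]) (by simp [mul_smul]) (by simp) (fun _ _ _ => by
        rw [map_smul, LinearMap.smul_apply, map_smul, smul_comm]))
      (conjugation w) (conjugation w) (pairing_conjugation w)
  -- After multiplication by `w²` the coefficients are those of `ρ` at the conjugated vectors `w fₐ
  -- w`, `w fᵦ w`. Conjugation is self-adjoint, so it can be moved to the dual vectors acting on
  -- `w·x`, where `h2` gives a factor `(w²)²`.
  refine smul_right_injective _ hw ?_
  simp only [Finset.smul_sum, smul_smul, h1]
  simp only [h3]
  rw [Finset.sum_comm]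
  simp only [h4, h2, map_sum, map_smul, Finset.smul_sum, smul_smul]
  rw [Finset.sum_comm]
  exact Finset.sum_congr rfl fun a _ => Finset.sum_congr rfl fun b _ => by
    congr 1
    ring

theorem fierzDefect_clifford (hB : IsSpinorForm B) (w : Doubled V) (hw : w.1 w.2 ≠ 0)
    (ρ x : Forms V) :
    fierzDefect B (clifford V w ρ) (clifford V w x) =
      w.1 w.2 • clifford V w (fierzDefect B ρ x) := by
  rw [fierzDefect, fierzDefect, hB.sum_linear_clifford, hB.sum_quadratic_clifford w hw, map_add,
    map_smul, smul_add, smul_comm (4 : ℝ)]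

end IsSpinorForm

theorem fierzDefect_add (ρ x y : Forms V) :
    fierzDefect B ρ (x + y) = fierzDefect B ρ x + fierzDefect B ρ y := by
  simp only [fierzDefect, map_add, add_smul, smul_add, Finset.sum_add_distrib]
  abel

theorem fierzDefect_smul (r : ℝ) (ρ x : Forms V) :
    fierzDefect B ρ (r • x) = r • fierzDefect B ρ x := by
  simp only [fierzDefect, map_smul, smul_add, Finset.smul_sum, smul_smul, smul_eq_mul]
  congr 1
  · exact Finset.sum_congr rfl fun a _ => by congr 1; ring
  · exact Finset.sum_congr rfl fun a _ => Finset.sum_congr rfl fun b _ => by congr 1; ring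

namespace IsSpinorForm

/-- The Fierz identity for spinors of opposite parity. -/
theorem fierzDefect_eq_zero (hB : IsSpinorForm B) (hne : B ≠ 0) (hV : Module.finrank ℝ V = 6)
    {n : ℕ} {x : Forms V} (hx : x ∈ ⋀[ℝ]^n (Module.Dual ℝ V)) {ρ : Forms V}
    (hρ : ρ ∈ CliffordAlgebra.evenOdd (0 : QuadraticForm ℝ (Module.Dual ℝ V)) (n + 1)) :
    fierzDefect B ρ x = 0 := by
  revert ρ
  refine forms_induction (p := fun n x => ∀ {ρ : Forms V},
    ρ ∈ CliffordAlgebra.evenOdd (0 : QuadraticForm ℝ (Module.Dual ℝ V)) (n + 1) →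
      fierzDefect B ρ x = 0) ?_ ?_ ?_ ?_ hx
  · intro ρ hρ
    exact hB.fierzDefect_one hne hV (by simpa using hρ)
  · intro n x y hx hy ρ hρ
    rw [fierzDefect_add, hx hρ, hy hρ, add_zero]
  · intro n r x hx ρ hρ
    rw [fierzDefect_smul, hx hρ, smul_zero]
  · intro n ξ x _ ih ρ hρ
    have key : ∀ w : Doubled V, w.1 w.2 ≠ 0 → fierzDefect B ρ (clifford V w x) = 0 := by
      intro w hw
      -- A nonisotropic `w` is invertible in the Clifford algebra, so `ρ` is `w` times a spinor of
      -- the other parity, to which the induction hypothesis applies.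
      have e : ρ = clifford V w ((w.1 w.2)⁻¹ • clifford V w ρ) := by
        rw [map_smul, clifford_sq_apply, smul_smul, inv_mul_cancel₀ hw, one_smul]
      have hmem : (w.1 w.2)⁻¹ • clifford V w ρ ∈
          CliffordAlgebra.evenOdd (0 : QuadraticForm ℝ (Module.Dual ℝ V)) (n + 1) := by
        refine Submodule.smul_mem _ _ ?_
        have h := clifford_mem_evenOdd hρ w
        have h2 : ((n + 1 : ℕ) : ZMod 2) + 1 + 1 = (n : ZMod 2) + 1 := by
          push_cast
          rw [add_assoc, add_assoc, show (1 + (1 + 1) : ZMod 2) = 1 from rfl]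
        rwa [h2] at h
      rw [e, hB.fierzDefect_clifford w hw, ih hmem, map_zero, smul_zero]
    by_cases hξ : ξ = 0
    · rw [hξ, map_zero, map_zero, LinearMap.zero_apply]
      simpa using fierzDefect_smul (B := B) 0 ρ 0
    -- The covector `ξ` is isotropic, but it is the mean of `ξ + v` and `ξ - v`, whose squares `±
    -- ξ(v)` are not zero.
    · obtain ⟨v, hv⟩ : ∃ v, ξ v ≠ 0 := by
        by_contra h
        push Not at h
        exact hξ (LinearMap.ext h)
      have h1 : (covec V ξ + vec V v).1 (covec V ξ + vec V v).2 = ξ v := by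
        change (ξ + 0) (0 + v) = _
        simp
      have h2 : (covec V ξ - vec V v).1 (covec V ξ - vec V v).2 = -ξ v := by
        change (ξ - 0) (0 - v) = _
        simp
      have k1 := key (covec V ξ + vec V v) (by rwa [h1])
      have k2 := key (covec V ξ - vec V v) (by rw [h2]; exact neg_ne_zero.2 hv)
      have e : clifford V (covec V ξ) x = (1 / 2 : ℝ) • (clifford V (covec V ξ + vec V v) x +
          clifford V (covec V ξ - vec V v) x) := by
        rw [map_add, map_sub, LinearMap.add_apply, LinearMap.sub_apply]
        module
      rw [e, fierzDefect_smul, fierzDefect_add, k1, k2, add_zero, smul_zero]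

theorem fierzDefect_of_even (hB : IsSpinorForm B) (hne : B ≠ 0) (hV : Module.finrank ℝ V = 6)
    {x ρ : Forms V} (hx : x ∈ CliffordAlgebra.evenOdd (0 : QuadraticForm ℝ (Module.Dual ℝ V)) 1)
    (hρ : ρ ∈ CliffordAlgebra.evenOdd (0 : QuadraticForm ℝ (Module.Dual ℝ V)) 0) :
    fierzDefect B ρ x = 0 := by
  obtain ⟨x₁, h₁, x₃, h₃, x₅, h₅, rfl⟩ := exists_odd_components hV hx
  rw [fierzDefect_add, fierzDefect_add, hB.fierzDefect_eq_zero hne hV h₁ hρ,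
    hB.fierzDefect_eq_zero hne hV h₃ hρ, hB.fierzDefect_eq_zero hne hV h₅ hρ, add_zero, add_zero]

end IsSpinorForm

/-! ### The moment of an even spinor and its square -/

theorem spinRep_clifford (a : so V) (w : Doubled V) (x : Forms V) :
    spinRep V a (clifford V w x) = clifford V (a.1 w) x + clifford V w (spinRep V a x) :=
  sub_eq_iff_eq_add.1 (LinearMap.congr_fun (spinRep_commutator V a w) x)

theorem spinRep_mem_evenOdd (a : so V) {i : ZMod 2} {x : Forms V}
    (hx : x ∈ CliffordAlgebra.evenOdd (0 : QuadraticForm ℝ (Module.Dual ℝ V)) i) :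
    spinRep V a x ∈ CliffordAlgebra.evenOdd (0 : QuadraticForm ℝ (Module.Dual ℝ V)) i := by
  rw [spinRep_eq_sum_frame]
  refine Submodule.smul_mem _ _ (Submodule.sum_mem _ fun b _ => ?_)
  have h := clifford_mem_evenOdd (clifford_mem_evenOdd hx (dualFrame V b)) (a.1 (frame V b))
  rwa [add_assoc, show (1 + 1 : ZMod 2) = 0 from rfl, add_zero] at h

namespace IsMoment

variable {ρ : Forms V} {m : so V}

theorem spinRep_eq (hm : IsMoment B ρ m) (x : Forms V) :
    spinRep V m x = (1 / 8 : ℝ) • ∑ a, ∑ b,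
      B (clifford V (frame V a) (clifford V (frame V b) ρ)) ρ •
        clifford V (dualFrame V b) (clifford V (dualFrame V a) x) := by
  have h : ∀ a, clifford V (m.1 (frame V a)) (clifford V (dualFrame V a) x) =
      (1 / 4 : ℝ) • ∑ b, B (clifford V (frame V a) (clifford V (frame V b) ρ)) ρ •
        clifford V (dualFrame V b) (clifford V (dualFrame V a) x) := by
    intro a
    have e := sum_pairing_frame_smul_map ((clifford V).flip (clifford V (dualFrame V a) x))
      (m.1 (frame V a))
    simp only [LinearMap.flip_apply, hm (frame V a), mul_smul] at e
    rw [← e, Finset.smul_sum]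
  rw [spinRep_eq_sum_frame]
  simp only [h, ← Finset.smul_sum, smul_smul]
  norm_num

/-- The moment `m` of an even spinor `ρ` satisfies `3 (m u) · ρ = - u · σ(m) ρ`. -/
theorem three_smul_clifford (hm : IsMoment B ρ m) (hB : IsSpinorForm B) (hne : B ≠ 0)
    (hV : Module.finrank ℝ V = 6)
    (hρ : ρ ∈ CliffordAlgebra.evenOdd (0 : QuadraticForm ℝ (Module.Dual ℝ V)) 0)
    (u : Doubled V) :
    (3 : ℝ) • clifford V (m.1 u) ρ = -clifford V u (spinRep V m ρ) := by
  have hx : clifford V u ρ ∈ CliffordAlgebra.evenOdd (0 : QuadraticForm ℝ (Module.Dual ℝ V)) 1 :=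
    by simpa using clifford_mem_evenOdd hρ u
  have h := hB.fierzDefect_of_even hne hV hx hρ
  have h1 : ∑ a, B ρ (clifford V (dualFrame V a) (clifford V u ρ)) • clifford V (frame V a) ρ =
      (4 : ℝ) • clifford V (m.1 u) ρ := by
    have e := sum_pairing_dualFrame_smul_map ((clifford V).flip ρ) (m.1 u)
    simp only [LinearMap.flip_apply] at e
    rw [← e, Finset.smul_sum]
    refine Finset.sum_congr rfl fun a _ => ?_
    rw [← hB.adjoint, ← hB.adjoint, hm, smul_smul]
    congr 1
    ring
  have h2 := hm.spinRep_eq (clifford V u ρ)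
  rw [fierzDefect, h1] at h
  rw [spinRep_clifford] at h2
  -- The Fierz identity at `x = u·ρ` reads `16 (m u)·ρ + 8 σ(m)(u·ρ) = 0`, and `σ(m)(u·ρ) = (m u)·ρ
  -- + u·σ(m) ρ`.
  linear_combination (norm := module) (1 / 8 : ℝ) • h + h2

end IsMoment

section Square

variable {ρ : Forms V} {m : so V}

/-- Applying `σ(m)` to the relation `h` and commuting it past the vectors gives `u·σ(m)² ρ = -3 (m²
u)·ρ - 4 (m u)·σ(m) ρ`. The relation at `m u` turns the last term into `12 (m² u)·ρ`. -/
theorem clifford_spinRep_spinRep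
    (h : ∀ u, (3 : ℝ) • clifford V (m.1 u) ρ = -clifford V u (spinRep V m ρ)) (u : Doubled V) :
    clifford V u (spinRep V m (spinRep V m ρ)) = (9 : ℝ) • clifford V (m.1 (m.1 u)) ρ := by
  have h1 := congrArg (spinRep V m) (h u)
  rw [map_smul, map_neg, spinRep_clifford, spinRep_clifford] at h1
  have h2 := h (m.1 u)
  linear_combination (norm := module) h1 - (4 : ℝ) • h2

/-- Contract the preceding relation with a frame: `∑ fₐ·fᵃ· = 12/2` on the left and `∑ fₐ·(m² fᵃ)· =
tr m² / 2` on the right. -/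
theorem spinRep_spinRep (hV : Module.finrank ℝ V = 6)
    (h : ∀ u, (3 : ℝ) • clifford V (m.1 u) ρ = -clifford V u (spinRep V m ρ)) :
    spinRep V m (spinRep V m ρ) =
      (3 / 4 * LinearMap.trace ℝ (Doubled V) (m.1 * m.1)) • ρ := by
  have h1 := sum_frame_anticomm (1 : Module.End ℝ (Doubled V)) (fun _ _ => rfl)
    (spinRep V m (spinRep V m ρ))
  have h2 := sum_frame_anticomm (m.1 * m.1) (pairing_sq m) ρ
  simp only [Module.End.one_apply, clifford_spinRep_spinRep h, LinearMap.trace_one,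
    finrank_doubled, hV, map_smul, ← Finset.smul_sum] at h1
  simp only [Module.End.mul_apply] at h2
  rw [h2] at h1
  push_cast at h1
  linear_combination (norm := module) (-1 / 6 : ℝ) • h1

/-- The square of the moment is the scalar `q / 12`, if `q` is not zero. -/
theorem IsMoment.sq_eq (hm : IsMoment B ρ m) (hB : IsSpinorForm B) (hV : Module.finrank ℝ V = 6)
    (h : ∀ u, (3 : ℝ) • clifford V (m.1 u) ρ = -clifford V u (spinRep V m ρ)) {q : ℝ}
    (hq : LinearMap.trace ℝ (Doubled V) (m.1 * m.1) = q) (hq0 : q ≠ 0) :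
    m.1 * m.1 = (q / 12) • (1 : Module.End ℝ (Doubled V)) := by
  have h1 : ∀ u, m.1 (m.1 (m.1 u)) = (q / 12) • m.1 u := by
    intro u
    have e : clifford V (m.1 (m.1 u) - (q / 12) • u) ρ = 0 := by
      have e1 := clifford_spinRep_spinRep h u
      rw [spinRep_spinRep hV h, hq, map_smul] at e1
      rw [map_sub, map_smul, LinearMap.sub_apply, LinearMap.smul_apply]
      linear_combination (norm := module) (-1 / 9 : ℝ) • e1
    have e2 := hm.eq_zero_of_clifford hB e
    rw [map_sub, map_smul] at e2
    exact sub_eq_zero.1 e2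
  -- Since `m³ = (q/12) m`, this is the projection onto `ker m`, and its trace `12 - (12/q) q` is
  -- the dimension of that kernel.
  set P : Module.End ℝ (Doubled V) := 1 - (12 / q) • (m.1 * m.1) with hP
  have hidem : IsIdempotentElem P := by
    refine LinearMap.ext fun u => ?_
    simp only [hP, Module.End.mul_apply, LinearMap.sub_apply, LinearMap.smul_apply,
      Module.End.one_apply, map_sub, map_smul, h1, smul_smul]
    rw [div_mul_div_cancel₀ hq0]
    module
  have htr : LinearMap.trace ℝ (Doubled V) P = 0 := by
    rw [hP, map_sub, map_smul, hq, LinearMap.trace_one, finrank_doubled, hV, smul_eq_mul,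
      div_mul_cancel₀ _ hq0]
    norm_num
  have hP0 := LinearMap.IsIdempotentElem.eq_zero_of_trace_eq_zero hidem htr
  have e := (sub_eq_zero.1 (hP.symm.trans hP0))
  rw [e, smul_smul, div_mul_div_cancel₀ (by norm_num : (12 : ℝ) ≠ 0), div_self hq0, one_smul]

end Square

end Fierz

/-! ### The form on spinors after a generator of the line is chosen -/

section Form

variable {V : Type*} [AddCommGroup V] [Module ℝ V]

theorem vec_mul {n : ℕ} {x : Forms V} (hx : x ∈ ⋀[ℝ]^n (Module.Dual ℝ V)) (v : V)
    (y : Forms V) :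
    clifford V (vec V v) (x * y) =
      clifford V (vec V v) x * y + (-1 : ℝ) ^ n • (x * clifford V (vec V v) y) := by
  refine forms_induction (p := fun n x => clifford V (vec V v) (x * y) =
      clifford V (vec V v) x * y + (-1 : ℝ) ^ n • (x * clifford V (vec V v) y)) ?_ ?_ ?_ ?_ hx
  · simp [clifford_vec_one]
  · intro n x z hx hz
    rw [add_mul, map_add, hx, hz, map_add, add_mul, add_mul, smul_add]
    abel
  · intro n r x hx
    rw [smul_mul_assoc, map_smul, hx, map_smul, smul_mul_assoc, smul_mul_assoc, smul_add,
      smul_comm r]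
  · intro n ξ x _ ih
    have h : ∀ z : Forms V, clifford V (covec V ξ) x * z = clifford V (covec V ξ) (x * z) := by
      intro z
      rw [clifford_covec, clifford_covec, mul_assoc]
    have h' : clifford V (covec V ξ) (clifford V (vec V v) x) * y =
        clifford V (covec V ξ) (clifford V (vec V v) x * y) := by
      rw [clifford_covec, clifford_covec, mul_assoc]
    rw [h, h, clifford_swap, ih, clifford_swap (vec V v) (covec V ξ) x, sub_mul, h', map_add,
      map_smul, smul_mul_assoc, pow_succ]
    module

theorem mul_mem_exteriorPower {p q : ℕ} {x y : Forms V} (hx : x ∈ ⋀[ℝ]^p (Module.Dual ℝ V))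
    (hy : y ∈ ⋀[ℝ]^q (Module.Dual ℝ V)) : x * y ∈ ⋀[ℝ]^(p + q) (Module.Dual ℝ V) :=
  SetLike.mul_mem_graded hx hy

/-- Covectors are self-adjoint because reversal is an antiautomorphism fixing them. Contractions are
so because they are antiderivations and there are no forms of degree 7. Skewness comes from the sign
of reversal in degree 6. -/
theorem isSpinorForm_of_reverse [FiniteDimensional ℝ V] (hV : Module.finrank ℝ V = 6)
    {B : LinearMap.BilinForm ℝ (Forms V)} (L : Forms V →ₗ[ℝ] ℝ)
    (hL : ∀ n ≠ 6, ∀ x ∈ ⋀[ℝ]^n (Module.Dual ℝ V), L x = 0)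
    (hB : ∀ x y, B x y =
      L ((CliffordAlgebra.reverse (Q := (0 : QuadraticForm ℝ (Module.Dual ℝ V))) x : Forms V) *
        y)) :
    IsSpinorForm B := by
  have hdeg : ∀ {p q : ℕ} {x y : Forms V}, x ∈ ⋀[ℝ]^p (Module.Dual ℝ V) →
      y ∈ ⋀[ℝ]^q (Module.Dual ℝ V) → p + q ≠ 6 → B x y = 0 := by
    intro p q x y hx hy h
    rw [hB, reverse_of_mem hx, smul_mul_assoc, map_smul, hL _ h _ (mul_mem_exteriorPower hx hy),
      smul_zero]
  refine ⟨fun w x y => ?_, fun x y => ?_, hdeg⟩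
  · have hcov : ∀ ξ, B (clifford V (covec V ξ) x) y = B x (clifford V (covec V ξ) y) := by
      intro ξ
      rw [hB, hB, clifford_covec, clifford_covec, CliffordAlgebra.reverse.map_mul]
      erw [CliffordAlgebra.reverse_ι]
      rw [mul_assoc]
    have hvec : ∀ v, B (clifford V (vec V v) x) y = B x (clifford V (vec V v) y) := by
      intro v
      have e : B ∘ₗ clifford V (vec V v) = B.compl₂ (clifford V (vec V v)) := by
        refine linearMap_ext_homogeneous fun p x hx => linearMap_ext_homogeneous fun q y hy => ?_
        rw [LinearMap.comp_apply, LinearMap.compl₂_apply]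
        -- Contraction lowers the degree by one, so both sides vanish unless the degrees add up to
        -- 7. In that case `x ∧ y = 0`, and contracting this with `v` relates the two sides up to a
        -- sign that reversal absorbs.
        by_cases h7 : p + q = 7
        · rcases p with _ | p
          · rw [vec_of_mem_zero hx, map_zero, LinearMap.zero_apply]
            have : y = 0 := eq_zero_of_finrank_lt (n := q) (by omega) hy
            rw [this, map_zero, map_zero]
          · have h0 := vec_mul hx v y
            rw [eq_zero_of_finrank_lt (n := p + 1 + q) (by omega) (mul_mem_exteriorPower hx hy),
              map_zero] at h0
            rw [hB, hB, reverse_of_mem hx, reverse_of_mem (vec_mem hx v), smul_mul_assoc,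
              smul_mul_assoc, eq_neg_of_add_eq_zero_left h0.symm, smul_neg, ← neg_smul, smul_smul]
            congr 2
            rcases Nat.even_or_odd' p with ⟨k, rfl | rfl⟩
            · rw [show (2 * k + 1) / 2 = k by omega, show 2 * k / 2 = k by omega, pow_succ,
                pow_mul]
              simp
            · rw [show (2 * k + 1 + 1) / 2 = k + 1 by omega, show (2 * k + 1) / 2 = k by omega,
                show 2 * k + 1 + 1 = 2 * (k + 1) by ring, pow_mul, pow_succ (-1 : ℝ) k]
              simp
        · have hl : B (clifford V (vec V v) x) y = 0 := by
            rcases p with _ | p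
            · rw [vec_of_mem_zero hx, map_zero, LinearMap.zero_apply]
            · exact hdeg (vec_mem hx v) hy (by omega)
          have hr : B x (clifford V (vec V v) y) = 0 := by
            rcases q with _ | q
            · rw [vec_of_mem_zero hy, map_zero]
            · exact hdeg hx (vec_mem hy v) (by omega)
          rw [hl, hr]
      exact LinearMap.congr_fun (LinearMap.congr_fun e x) y
    rw [← covec_add_vec w]
    simp only [map_add, LinearMap.add_apply, hcov, hvec]
  · have e : B = -B.flip := by
      refine linearMap_ext_homogeneous fun p x hx => linearMap_ext_homogeneous fun q y hy => ?_
      change B x y = -B y x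
      by_cases h6 : p + q = 6
      · have hmem : (CliffordAlgebra.reverse (Q := (0 : QuadraticForm ℝ (Module.Dual ℝ V))) y :
            Forms V) * x ∈ ⋀[ℝ]^6 (Module.Dual ℝ V) := by
          rw [reverse_of_mem hy, smul_mul_assoc, ← h6, add_comm p q]
          exact Submodule.smul_mem _ _ (mul_mem_exteriorPower hy hx)
        have h := reverse_of_mem hmem
        rw [CliffordAlgebra.reverse.map_mul, CliffordAlgebra.reverse_reverse] at h
        rw [hB, hB, h]
        -- Reversal is `(-1)^(6/2) = -1` in degree 6.
        norm_num
      · rw [hdeg hx hy h6, hdeg hy hx (by omega), neg_zero]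
    exact LinearMap.congr_fun (LinearMap.congr_fun e x) y

variable {K : Type*} [AddCommGroup K] [Module ℝ K]

/-- The form `(x, y) ↦ ⟨x ⊗ k, y ⊗ k⟩` on `Λ*V*`. -/
def formAt (s : K ⊗[ℝ] K ≃ₗ[ℝ] ⋀[ℝ]^6 V) (k : K) : LinearMap.BilinForm ℝ (Forms V) :=
  (form s).compl₁₂ ((TensorProduct.mk ℝ (Forms V) K).flip k)
    ((TensorProduct.mk ℝ (Forms V) K).flip k)

theorem formAt_apply (s : K ⊗[ℝ] K ≃ₗ[ℝ] ⋀[ℝ]^6 V) (k : K) (x y : Forms V) :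
    formAt s k x y = form s (x ⊗ₜ k) (y ⊗ₜ k) := rfl

theorem isSpinorForm_formAt [FiniteDimensional ℝ V] (hV : Module.finrank ℝ V = 6)
    (s : K ⊗[ℝ] K ≃ₗ[ℝ] ⋀[ℝ]^6 V) (k : K) : IsSpinorForm (formAt s k) := by
  refine isSpinorForm_of_reverse hV
    ((exteriorPower.pairingDual ℝ V 6).flip (s (k ⊗ₜ k)) ∘ₗ
      (DirectSum.component ℝ ℕ (fun i => ⋀[ℝ]^i (Module.Dual ℝ V)) 6) ∘ₗ
      (DirectSum.decomposeLinearEquiv (fun i : ℕ => ⋀[ℝ]^i (Module.Dual ℝ V))).toLinearMap)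
    (fun n hn x hx => ?_) (fun x y => ?_)
  · have h : DirectSum.decompose (fun i : ℕ => ⋀[ℝ]^i (Module.Dual ℝ V)) x 6 = 0 :=
      Subtype.ext (DirectSum.decompose_of_mem_ne _ hx hn)
    change exteriorPower.pairingDual ℝ V 6
      (DirectSum.decompose (fun i : ℕ => ⋀[ℝ]^i (Module.Dual ℝ V)) x 6) _ = 0
    rw [h, map_zero, LinearMap.zero_apply]
  · rfl

theorem exists_generator [FiniteDimensional ℝ V] (hV : Module.finrank ℝ V = 6)
    (s : K ⊗[ℝ] K ≃ₗ[ℝ] ⋀[ℝ]^6 V) : ∃ k : K, k ≠ 0 ∧ ∀ l : K, ∃ c : ℝ, c • k = l := by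
  have h := s.finrank_eq
  rw [exteriorPower.finrank_eq, hV, Nat.choose_self, Module.finrank_tensorProduct] at h
  exact finrank_eq_one_iff'.1 (Nat.eq_one_of_mul_eq_one_right h)

theorem exists_even_tmul {k : K} (hk : ∀ l : K, ∃ c : ℝ, c • k = l) {ρ : Spinor V K}
    (hρ : ρ ∈ evenSpinors V K) :
    ∃ r ∈ CliffordAlgebra.evenOdd (0 : QuadraticForm ℝ (Module.Dual ℝ V)) 0, ρ = r ⊗ₜ k := by
  obtain ⟨t, rfl⟩ := hρ
  induction t using TensorProduct.induction_on with
  | zero => exact ⟨0, zero_mem _, by rw [map_zero, TensorProduct.zero_tmul]⟩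
  | tmul x l =>
    obtain ⟨c, rfl⟩ := hk l
    exact ⟨c • x.1, Submodule.smul_mem _ _ x.2, by simp [TensorProduct.smul_tmul]⟩
  | add x y hx hy =>
    obtain ⟨a, ha, hxa⟩ := hx
    obtain ⟨b, hb, hyb⟩ := hy
    exact ⟨a + b, add_mem ha hb, by rw [map_add, hxa, hyb, TensorProduct.add_tmul]⟩

theorem tmul_mem_evenSpinors {r : Forms V}
    (hr : r ∈ CliffordAlgebra.evenOdd (0 : QuadraticForm ℝ (Module.Dual ℝ V)) 0) (k : K) :
    r ⊗ₜ k ∈ evenSpinors V K :=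
  ⟨(⟨r, hr⟩ : CliffordAlgebra.evenOdd (0 : QuadraticForm ℝ (Module.Dual ℝ V)) 0) ⊗ₜ k, rfl⟩

theorem eq_zero_of_tmul_eq_zero {k : K} (hk : k ≠ 0) {X : Type*} [AddCommGroup X] [Module ℝ X]
    {x : X} (h : x ⊗ₜ[ℝ] k = 0) : x = 0 := by
  obtain ⟨f, hf⟩ : ∃ f : Module.Dual ℝ K, f k ≠ 0 := by
    by_contra hf
    push Not at hf
    exact hk ((Module.forall_dual_apply_eq_zero_iff ℝ k).1 hf)
  have h' := congrArg (TensorProduct.rid ℝ X ∘ f.lTensor X) h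
  simp only [Function.comp_apply, LinearMap.lTensor_tmul, TensorProduct.rid_tmul, map_zero] at h'
  exact (smul_eq_zero.1 h').resolve_left hf

end Form

/-! ### The moment map in terms of Clifford multiplication -/

section Moment

variable {V : Type*} [AddCommGroup V] [Module ℝ V] [FiniteDimensional ℝ V]
variable {K : Type*} [AddCommGroup K] [Module ℝ K]

theorem spinRep_wedge (u w : Doubled V) (x : Forms V) :
    spinRep V (wedge u w) x =
      (1 / 2 : ℝ) • (clifford V u (clifford V w x) - clifford V w (clifford V u x)) := by
  rw [spinRep_eq_sum_frame]
  congr 1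
  have e1 := sum_pairing_frame_smul_map (clifford V u ∘ₗ (clifford V).flip x) w
  have e2 := sum_pairing_frame_smul_map (clifford V w ∘ₗ (clifford V).flip x) u
  simp only [LinearMap.comp_apply, LinearMap.flip_apply] at e1 e2
  rw [← e1, ← e2, ← Finset.sum_sub_distrib]
  exact Finset.sum_congr rfl fun a _ => by simp [wedge]

theorem trace_mul_wedge (m : so V) (u w : Doubled V) :
    LinearMap.trace ℝ (Doubled V) (m.1 * (wedge u w).1) = 2 * pairing V (m.1 u) w := by
  have hmul : m.1 * (wedge u w).1 =
      (pairing V w).smulRight (m.1 u) - (pairing V u).smulRight (m.1 w) :=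
    LinearMap.ext fun x => by simp [wedge]
  rw [hmul, map_sub, LinearMap.trace_smulRight, LinearMap.trace_smulRight,
    pairing_comm w, (mem_so_iff m.1).1 m.2 u w]
  ring

theorem trace_moment_tmul (s : K ⊗[ℝ] K ≃ₗ[ℝ] ⋀[ℝ]^6 V) (r : Forms V) (k : K) (a : so V) :
    LinearMap.trace ℝ (Doubled V) ((moment s (r ⊗ₜ k)).1 * a.1) =
      1 / 2 * formAt s k (spinRep V a r) r := by
  rw [trace_moment_mul, LinearMap.rTensor_tmul, formAt_apply]

/-- Test the moment on `wedge u w`. The trace is `2 (m u, w)`, and `σ(wedge u w)` is half the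
commutator of `u` and `w`, whose two terms contribute equally. This gives the constant `¼`. -/
theorem isMoment_moment (hV : Module.finrank ℝ V = 6) (s : K ⊗[ℝ] K ≃ₗ[ℝ] ⋀[ℝ]^6 V)
    (r : Forms V) (k : K) : IsMoment (formAt s k) r (moment s (r ⊗ₜ k)) := by
  intro u w
  have h := trace_moment_tmul s r k (wedge u w)
  rw [trace_mul_wedge, spinRep_wedge, map_smul, map_sub, LinearMap.smul_apply,
    LinearMap.sub_apply, (isSpinorForm_formAt hV s k).clifford_clifford_swap w u,
    smul_eq_mul] at h
  linarith

end Moment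

/-! ### Complex spinors, annihilators and conjugation -/

section Complexification

variable {W : Type*} [AddCommGroup W] [Module ℝ W]

theorem exists_re_im (t : ℂ ⊗[ℝ] W) :
    ∃ a b : W, t = (1 : ℂ) ⊗ₜ[ℝ] a + Complex.I ⊗ₜ[ℝ] b := by
  induction t using TensorProduct.induction_on with
  | zero => exact ⟨0, 0, by simp⟩
  | tmul z w =>
    refine ⟨z.re • w, z.im • w, ?_⟩
    rw [← TensorProduct.smul_tmul, ← TensorProduct.smul_tmul, ← TensorProduct.add_tmul]
    congr 1
    apply Complex.ext <;> simp
  | add x y hx hy =>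
    obtain ⟨a, b, rfl⟩ := hx
    obtain ⟨c, d, rfl⟩ := hy
    exact ⟨a + c, b + d, by rw [TensorProduct.tmul_add, TensorProduct.tmul_add]; abel⟩

theorem re_im_eq_zero {a b : W} (h : (1 : ℂ) ⊗ₜ[ℝ] a + Complex.I ⊗ₜ[ℝ] b = 0) :
    a = 0 ∧ b = 0 := by
  have hr := congrArg (TensorProduct.lid ℝ W ∘ Complex.reLm.rTensor W) h
  have hi := congrArg (TensorProduct.lid ℝ W ∘ Complex.imLm.rTensor W) h
  constructor
  · simpa using hr
  · simpa using hi

variable {V K : Type*} [AddCommGroup V] [Module ℝ V] [AddCommGroup K] [Module ℝ K]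

theorem cliffordC_re_im (a b : Doubled V) (x y : Forms V) (k : K) :
    cliffordC ((1 : ℂ) ⊗ₜ[ℝ] a + Complex.I ⊗ₜ[ℝ] b)
        ((1 : ℂ) ⊗ₜ[ℝ] (x ⊗ₜ[ℝ] k) + Complex.I ⊗ₜ[ℝ] (y ⊗ₜ[ℝ] k) : ℂ ⊗[ℝ] Spinor V K) =
      (1 : ℂ) ⊗ₜ[ℝ] ((clifford V a x - clifford V b y) ⊗ₜ[ℝ] k) +
        Complex.I ⊗ₜ[ℝ] ((clifford V a y + clifford V b x) ⊗ₜ[ℝ] k) := by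
  simp only [map_add, LinearMap.add_apply, cliffordC_tmul, one_mul, mul_one, Complex.I_mul_I,
    TensorProduct.sub_tmul, TensorProduct.add_tmul, TensorProduct.tmul_sub,
    TensorProduct.tmul_add, TensorProduct.neg_tmul]
  abel

/-- If `m² = -λ²` and `φ = ρ + i ρ'` with `(m u) ρ = λ u ρ'` and `(m u) ρ' = -λ u ρ`, then the
annihilator of `φ` is the graph `{λ⁻¹ m b + i b}`. -/
theorem finrank_annihilator [FiniteDimensional ℝ V] {k : K} (hk : k ≠ 0) {r r' : Forms V}
    {m : Module.End ℝ (Doubled V)} {c : ℝ} (hc : c ≠ 0)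
    (h1 : ∀ u, clifford V (m u) r = c • clifford V u r')
    (h2 : ∀ u, clifford V (m u) r' = -(c • clifford V u r))
    (h3 : ∀ u, clifford V u r = 0 → u = 0) :
    Module.finrank ℂ (annihilator
      ((1 : ℂ) ⊗ₜ[ℝ] (r ⊗ₜ[ℝ] k) + Complex.I ⊗ₜ[ℝ] (r' ⊗ₜ[ℝ] k) : ℂ ⊗[ℝ] Spinor V K)) =
      Module.finrank ℝ V := by
  set φ : ℂ ⊗[ℝ] Spinor V K :=
    (1 : ℂ) ⊗ₜ[ℝ] (r ⊗ₜ[ℝ] k) + Complex.I ⊗ₜ[ℝ] (r' ⊗ₜ[ℝ] k) with hφ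
  let g : Doubled V →ₗ[ℝ] ℂ ⊗[ℝ] Doubled V :=
    TensorProduct.mk ℝ ℂ (Doubled V) 1 ∘ₗ (c⁻¹ • m) +
      TensorProduct.mk ℝ ℂ (Doubled V) Complex.I
  have hg : ∀ b, g b = (1 : ℂ) ⊗ₜ[ℝ] (c⁻¹ • m b) + Complex.I ⊗ₜ[ℝ] b := fun b => rfl
  have hinj : Function.Injective g := by
    rw [← LinearMap.ker_eq_bot, LinearMap.ker_eq_bot']
    intro b hb
    exact (re_im_eq_zero ((hg b).symm.trans hb)).2
  have hrange : LinearMap.range g = (annihilator φ).restrictScalars ℝ := by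
    ext t
    rw [Submodule.restrictScalars_mem, annihilator, LinearMap.mem_ker, LinearMap.flip_apply,
      LinearMap.mem_range]
    constructor
    · rintro ⟨b, rfl⟩
      rw [hg, hφ, cliffordC_re_im]
      simp only [map_smul, LinearMap.smul_apply, h1, h2, smul_neg, smul_smul,
        inv_mul_cancel₀ hc, one_smul]
      simp
    · intro ht
      obtain ⟨a, b, rfl⟩ := exists_re_im t
      rw [hφ, cliffordC_re_im] at ht
      -- The real part `a·r = b·r'` alone determines `a`, because `b·r' = c⁻¹ (m b)·r` and no
      -- nonzero real vector annihilates `r`.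
      have e := eq_zero_of_tmul_eq_zero hk (re_im_eq_zero ht).1
      have e' : a - c⁻¹ • m b = 0 := by
        refine h3 _ ?_
        simp only [map_sub, map_smul, LinearMap.sub_apply, LinearMap.smul_apply, h1, smul_smul,
          inv_mul_cancel₀ hc, one_smul, e]
      exact ⟨b, by rw [hg, sub_eq_zero.1 e']⟩
  have hfin := LinearMap.finrank_range_of_inj hinj
  rw [hrange, finrank_doubled] at hfin
  have h : Module.finrank ℝ ((annihilator φ).restrictScalars ℝ) =
      2 * Module.finrank ℂ (annihilator φ) := by
    rw [← Complex.finrank_real_complex]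
    exact (Module.finrank_mul_finrank ℝ ℂ ((annihilator φ).restrictScalars ℝ)).symm
  -- The annihilator is a real copy of `V ⊕ V*`, so twice its complex dimension is `2 dim V`.
  omega

theorem realPart_re_im (x y : Spinor V K) :
    realPart ((1 : ℂ) ⊗ₜ[ℝ] x + Complex.I ⊗ₜ[ℝ] y) = x := by
  simp [realPart]

theorem formC_conj (s : K ⊗[ℝ] K ≃ₗ[ℝ] ⋀[ℝ]^6 V) (x y : Spinor V K) :
    formC s ((1 : ℂ) ⊗ₜ[ℝ] x + Complex.I ⊗ₜ[ℝ] y)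
        (conj ((1 : ℂ) ⊗ₜ[ℝ] x + Complex.I ⊗ₜ[ℝ] y)) =
      ((form s x x + form s y y : ℝ) : ℂ) +
        ((form s y x - form s x y : ℝ) : ℂ) * Complex.I := by
  simp only [formC, conj, map_add, LinearMap.add_apply, LinearMap.rTensor_tmul,
    AlgEquiv.toLinearMap_apply, Complex.conjAe_coe, map_one, Complex.conj_I,
    LinearMap.BilinForm.baseChange_tmul]
  apply Complex.ext <;> simp
  ring

end Complexification

end SpinSix

end

/-! ### Construction of the pure spinor -/

theorem mainTheorem12 {V K : Type*} [AddCommGroup V] [Module ℝ V] [AddCommGroup K] [Module ℝ K]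
    [FiniteDimensional ℝ V] (hV : Module.finrank ℝ V = 6)
    (s : TensorProduct ℝ K K ≃ₗ[ℝ] ⋀[ℝ]^6 V)
    (ρ : SpinSix.Spinor V K) (hρ : ρ ∈ SpinSix.evenSpinors V K)
    (hq : SpinSix.quartic s ρ < 0) :
    ∃ φ : TensorProduct ℝ ℂ (SpinSix.Spinor V K),
      SpinSix.IsPure φ ∧ SpinSix.realPart φ = ρ ∧
        SpinSix.formC s φ (SpinSix.conj φ) ≠ 0 := by
  open SpinSix in
  obtain ⟨k, hk, hgen⟩ := exists_generator hV s
  obtain ⟨r, hr, rfl⟩ := exists_even_tmul hgen hρ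
  set m := moment s (r ⊗ₜ k) with hmdef
  have hB := isSpinorForm_formAt hV s k
  have hm : IsMoment (formAt s k) r m := isMoment_moment hV s r k
  set q := quartic s (r ⊗ₜ k) with hqdef
  have hqm : LinearMap.trace ℝ (Doubled V) (m.1 * m.1) = q := rfl
  -- If the form vanished, so would the moment, and then `q = 0`.
  have hne : formAt s k ≠ 0 := by
    intro h
    have h0 : ∀ u, m.1 u = 0 := fun u => eq_zero_of_pairing _ fun w => by
      rw [pairing_comm, hm, h]
      simp
    have h1 : m.1 * m.1 = 0 := LinearMap.ext fun u => h0 _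
    rw [h1, map_zero] at hqm
    exact hq.ne hqm.symm
  have h3 := hm.three_smul_clifford hB hne hV hr
  have hsq := hm.sq_eq hB hV h3 hqm hq.ne
  obtain ⟨c, hc, hcq⟩ : ∃ c : ℝ, c ≠ 0 ∧ q / 12 = -(c * c) := by
    have hpos : 0 < -q / 12 := by linarith
    refine ⟨√(-q / 12), (Real.sqrt_pos.2 hpos).ne', ?_⟩
    rw [Real.mul_self_sqrt hpos.le]
    ring
  have hsq' : ∀ u, m.1 (m.1 u) = -(c * c) • u := fun u => by
    rw [← hcq]
    exact LinearMap.congr_fun hsq u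
  -- The factor is chosen to turn `3 (m u)·r = -u·σ(m) r` into `(m u)·r = c u·r'`. The companion
  -- relation `e2` follows on replacing `u` by `m u`, since `m² = -c²`.
  set r' : Forms V := -(3 * c)⁻¹ • spinRep V m r with hr'
  have e1 : ∀ u, clifford V (m.1 u) r = c • clifford V u r' := by
    intro u
    have e : clifford V u (spinRep V m r) = -((3 : ℝ) • clifford V (m.1 u) r) := by
      rw [h3, neg_neg]
    rw [hr', map_smul, e, smul_neg, smul_smul, smul_neg, smul_smul, ← neg_smul]
    field_simp
    norm_num
  have e2 : ∀ u, clifford V (m.1 u) r' = -(c • clifford V u r) := by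
    intro u
    have e := e1 (m.1 u)
    rw [hsq', map_smul, LinearMap.smul_apply] at e
    refine smul_right_injective _ hc ?_
    change c • _ = c • _
    rw [← e]
    module
  have e3 : ∀ u, clifford V u r = 0 → u = 0 := by
    intro u hu
    have e := hsq' u
    rw [hm.eq_zero_of_clifford hB hu, map_zero] at e
    exact (smul_eq_zero.1 e.symm).resolve_left (neg_ne_zero.2 (mul_ne_zero hc hc))
  have hr'mem : r' ∈ CliffordAlgebra.evenOdd (0 : QuadraticForm ℝ (Module.Dual ℝ V)) 0 :=
    Submodule.smul_mem _ _ (spinRep_mem_evenOdd m hr)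
  refine ⟨(1 : ℂ) ⊗ₜ[ℝ] (r ⊗ₜ[ℝ] k) + Complex.I ⊗ₜ[ℝ] (r' ⊗ₜ[ℝ] k),
    ⟨add_mem (Submodule.tmul_mem_baseChange_of_mem _ (tmul_mem_evenSpinors hr k))
      (Submodule.tmul_mem_baseChange_of_mem _ (tmul_mem_evenSpinors hr'mem k)),
      finrank_annihilator hk hc e1 e2 e3⟩, realPart_re_im _ _, ?_⟩
  have hval : formAt s k (spinRep V m r) r = 2 * q := by
    have h := trace_moment_tmul s r k m
    rw [← hmdef, hqm] at h
    linarith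
  have hform : formAt s k r' r = -(3 * c)⁻¹ * (2 * q) := by
    rw [hr', map_smul, LinearMap.smul_apply, hval, smul_eq_mul]
  have hne' : -(3 * c)⁻¹ * (2 * q) ≠ 0 :=
    mul_ne_zero (neg_ne_zero.2 (inv_ne_zero (mul_ne_zero three_ne_zero hc)))
      (mul_ne_zero two_ne_zero hq.ne)
  rw [formC_conj]
  intro h
  -- The imaginary part is `B(r', r) - B(r, r') = 2 B(r', r)` by skewness, and `B(r', r)` is a
  -- nonzero multiple of `q`.
  have h' := congrArg Complex.im h
  have hskew := hB.skew r r'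
  simp only [formAt_apply] at hform hskew
  simp only [Complex.add_im, Complex.ofReal_im, Complex.mul_im, Complex.ofReal_re, Complex.I_re,
    Complex.I_im, Complex.zero_im] at h'
  rw [hskew, hform] at h'
  exact hne' (by linarith)
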